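/- Fix a separable infinite-dimensional complex Hilbert space $L$ and a unitary isomorphism $\iota$ from the Hilbert tensor product $L\mathbin{\dot\otimes}L$ onto $L$. Let $\mathcal B$ be the algebra of bounded operators on $L$, let $\mathcal K\subseteq\mathcal B$ be the ideal of finite rank operators, and put $a\diamond b:=\iota(a\mathbin{\dot\otimes}b)\iota^{-1}$ for $a,b\in\mathcal B$. For a complex linear space $E$, the space $\mathcal K E:=\mathcal K\otimes E$ is a $\mathcal B$-bimodule via $a\cdot(k\otimes x)\cdot b=akb\otimes x$. A *PQ-space* is a linear space $E$ with a norm on $\mathcal KE$ such that $\|a\cdot u\cdot b\|\le\|a\|\,\|u\|\,\|b\|$ for all $a,b\in\mathcal B$, $u\in\mathcal KE$; its underlying normed space is $E$ with $\|x\|:=\|Q\otimes x\|$, where $Q$ is any operator of rank $1$ and norm $1$, and $E$ is *complete* if this underlying space is complete. For $p\in[1,\infty]$, $E$ is *$p$-convex* if $\|\sum_{k=1}^n u_k\|\le(\sum_{k=1}^n\|u_k\|^p)^{1/p}$ (read as $\max_k\|u_k\|$ on the right if $p=\infty$) whenever $u_k\in\mathcal KE$ satisfy $P_k\cdot u_k\cdot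 P_k=u_k$ for pairwise orthogonal projections $P_1,\dots,P_n\in\mathcal B$. A linear isomorphism $I:E\to F$ of PQ-spaces is *completely isometric* if $\mathrm{id}_{\mathcal K}\otimes I:\mathcal KE\to\mathcal KF$ is isometric. * ${}^{(p)}\mathbb C$ is $\mathbb C$ with the $p$-th Schatten norm on $\mathcal K\otimes\mathbb C=\mathcal K$. * For a measure space $(X,\mu)$ and a PQ-space $E$, the space $L_1(X,E)$ of (classes of) Bochner integrable functions is a PQ-space with $\|\sum_i a_i\otimes x_i\|:=\int_X\|\sum_i a_i\otimes x_i(t)\|\,d\mu(t)$. * For PQ-spaces $E,F$, $E\otimes_{pop}F$ is $E\otimes F$ with the norm on $\mathcal K(E\otimes F)$ $$\|U\|_{pop}:=\inf\Big\{\sum_{k=1}^n\|a_k\|\,\|u_k\|\,\|v_k\|\,\|b_k\| : U=\sum_{k=1}^n a_k\cdot(u_k\diamond v_k)\cdot b_k\Big\},$$ where $a_k,b_k\in\mathcal B$, $u_k\in\mathcal KE$, $v_k\in\mathcal KF$ and $(a\otimes x)\diamond(b\otimes y):=(a\diamond b)\otimes(x\otimes y)$. Further, $E\,\widehat\otimes_{pop}F$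 is its completion: the completion $G$ of the underlying normed space, with the norm on $\mathcal K G$ induced by the natural map of $\mathcal K G$ into the completion of $\mathcal K(E\otimes F)$. **Theorem.** Let $p\in[1,\infty]$, let $(X,\mu)$ be a measure space, and let $F$ be a complete $p$-convex PQ-space. Then there is a completely isometric isomorphism $$I: L_1(X,{}^{(p)}\mathbb C)\,\widehat\otimes_{pop}F\;\longrightarrow\;L_1(X,F)$$ such that $I(z\otimes y)$ is the function $t\mapsto z(t)\,y$ for all $z\in L_1(X,{}^{(p)}\mathbb C)$ and $y\in F$. -/

import Mathlib

open scoped TensorProduct ENNReal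
open MeasureTheory InnerProductSpace

noncomputable section

namespace Proto

section FiniteRank

variable (L : Type*) [NormedAddCommGroup L] [InnerProductSpace ℂ L]

/-- The (non-closed) ideal of bounded operators of finite rank on `L`. -/
def finiteRank : Submodule ℂ (L →L[ℂ] L) where
  carrier := {a | FiniteDimensional ℂ (LinearMap.range (a : L →ₗ[ℂ] L))}
  zero_mem' := by
    have : LinearMap.range ((0 : L →L[ℂ] L) : L →ₗ[ℂ] L) = ⊥ := by
      ext; simp
    change FiniteDimensional ℂ (LinearMap.range ((0 : L →L[ℂ] L) : L →ₗ[ℂ] L))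
    rw [this]
    infer_instance
  add_mem' := by
    intro a b (ha : FiniteDimensional ℂ _) (hb : FiniteDimensional ℂ _)
    refine Submodule.finiteDimensional_of_le
      (S₂ := LinearMap.range (a : L →ₗ[ℂ] L) ⊔ LinearMap.range (b : L →ₗ[ℂ] L)) ?_
    rintro _ ⟨x, rfl⟩
    exact Submodule.add_mem_sup ⟨x, rfl⟩ ⟨x, rfl⟩
  smul_mem' := by
    intro c a (ha : FiniteDimensional ℂ _)
    refine Submodule.finiteDimensional_of_le (S₂ := LinearMap.range (a : L →ₗ[ℂ] L)) ?_
    rintro _ ⟨x, rfl⟩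
    exact ⟨c • x, by simp⟩

/-- The complex linear space of bounded operators of finite rank on `L`, without a topology. -/
def K : Type _ := finiteRank L

instance : AddCommGroup (K L) := inferInstanceAs (AddCommGroup (finiteRank L))

instance : Module ℂ (K L) := inferInstanceAs (Module ℂ (finiteRank L))

variable {L}

/-- An element of `K L` as a bounded operator. -/
def op : K L →ₗ[ℂ] L →L[ℂ] L := (finiteRank L).subtype

theorem op_finite (k : K L) : FiniteDimensional ℂ (LinearMap.range (op k : L →ₗ[ℂ] L)) := k.2

/-- A bounded operator of finite rank as an element of `K L`. -/
def mkK (a : L →L[ℂ] L) (h : FiniteDimensional ℂ (LinearMap.range (a : L →ₗ[ℂ] L))) : K L :=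
  ⟨a, h⟩

@[simp]
theorem op_mkK (a : L →L[ℂ] L) (h : FiniteDimensional ℂ (LinearMap.range (a : L →ₗ[ℂ] L))) :
    op (mkK a h) = a := rfl

theorem op_injective : Function.Injective (op : K L → L →L[ℂ] L) := Subtype.val_injective

theorem K_ext {a b : K L} (h : ∀ x, op a x = op b x) : a = b :=
  op_injective (ContinuousLinearMap.ext h)

theorem sandwich_finite (a b : L →L[ℂ] L) (k : K L) :
    FiniteDimensional ℂ (LinearMap.range ((a ∘L op k ∘L b : L →L[ℂ] L) : L →ₗ[ℂ] L)) := by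
  have := op_finite k
  refine Submodule.finiteDimensional_of_le
    (S₂ := (LinearMap.range (op k : L →ₗ[ℂ] L)).map (a : L →ₗ[ℂ] L)) ?_
  rintro _ ⟨x, rfl⟩
  exact ⟨op k (b x), ⟨b x, rfl⟩, rfl⟩

/-- `k ↦ a k b` on finite rank operators, for bounded operators `a`, `b`. -/
def sandwich (a b : L →L[ℂ] L) : K L →ₗ[ℂ] K L where
  toFun k := mkK (a ∘L op k ∘L b) (sandwich_finite a b k)
  map_add' x y := K_ext fun _ => by simp
  map_smul' c x := K_ext fun _ => by simp

theorem op_sandwich (a b : L →L[ℂ] L) (k : K L) : op (sandwich a b k) = a ∘L op k ∘L b := rfl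

theorem rankOne_finite (ξ η : L) :
    FiniteDimensional ℂ (LinearMap.range (rankOne ℂ ξ η : L →ₗ[ℂ] L)) := by
  refine Submodule.finiteDimensional_of_le (S₂ := Submodule.span ℂ {ξ}) ?_
  rintro _ ⟨x, rfl⟩
  exact Submodule.mem_span_singleton.2 ⟨_, rfl⟩

/-- The operator `ξ ∘ η : ζ ↦ ⟨ζ, η⟩ ξ`; for unit vectors these are exactly the operators of
rank one and norm one. -/
def rk (ξ η : L) : K L := mkK (rankOne ℂ ξ η) (rankOne_finite ξ η)

theorem op_rk (ξ η : L) : op (rk ξ η) = rankOne ℂ ξ η := rfl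

/-- The two-sided action of the algebra of bounded operators on the amplification `K ⊗ E`:
`bimod E a b u` is `a · u · b`. -/
def bimod (E : Type*) [AddCommGroup E] [Module ℂ E] (a b : L →L[ℂ] L) :
    K L ⊗[ℂ] E →ₗ[ℂ] K L ⊗[ℂ] E :=
  (sandwich a b).rTensor E

theorem sandwich_rk [CompleteSpace L] (a b : L →L[ℂ] L) (ξ η : L) :
    sandwich a b (rk ξ η) = rk (a ξ) (b.adjoint η) := by
  refine K_ext fun x => ?_
  simp [op_sandwich, op_rk, ContinuousLinearMap.adjoint_inner_left]

theorem sandwich_sandwich (a b c d : L →L[ℂ] L) (k : K L) :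
    sandwich a b (sandwich c d k) = sandwich (a ∘L c) (d ∘L b) k := rfl

theorem bimod_bimod (E : Type*) [AddCommGroup E] [Module ℂ E] (a b c d : L →L[ℂ] L)
    (u : K L ⊗[ℂ] E) : bimod E a b (bimod E c d u) = bimod E (a ∘L c) (d ∘L b) u := by
  induction u with
  | zero => simp
  | tmul k x => simp [bimod, sandwich_sandwich]
  | add u v hu hv => simp [hu, hv]

/-- Every operator of finite rank is a finite sum of operators of rank one. -/
theorem exists_sum_rk [CompleteSpace L] (a : K L) :
    ∃ (n : ℕ) (ξ η : Fin n → L), a = ∑ i, rk (ξ i) (η i) := by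
  have := op_finite a
  let b := stdOrthonormalBasis ℂ (LinearMap.range (op a : L →ₗ[ℂ] L))
  refine ⟨_, fun i => (b i : L), fun i => (op a).adjoint (b i : L), K_ext fun x => ?_⟩
  have h := b.sum_repr' ⟨op a x, ⟨x, rfl⟩⟩
  have h' := congrArg (Subtype.val) h
  simp only [Submodule.coe_sum, Submodule.coe_smul, Submodule.coe_inner] at h'
  simp [op_rk, ContinuousLinearMap.adjoint_inner_left, h']

end FiniteRank

section Spaces

variable (L : Type*) [NormedAddCommGroup L] [InnerProductSpace ℂ L]

/-- A proto-quantum semi-norm on the linear space `E`: a semi-norm on the amplification `K ⊗ E`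
for which this bimodule is contractive. -/
structure PQSeminorm (E : Type*) [AddCommGroup E] [Module ℂ E] extends
    Seminorm ℂ (K L ⊗[ℂ] E) where
  contractive' : ∀ (a b : L →L[ℂ] L) (u : K L ⊗[ℂ] E),
    toFun (bimod E a b u) ≤ ‖a‖ * toFun u * ‖b‖

/-- The structure of a (semi-normed) proto-quantum space whose underlying (semi-)normed space is
`E`: a proto-quantum semi-norm on `E` with `‖Q ⊗ x‖ = ‖x‖` for every operator `Q` of rank one and
norm one. If `E` is a normed space, then the semi-norm on `K ⊗ E` is automatically a norm, see
`PQSpace.eq_zero` below. -/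
structure PQSpace (E : Type*) [SeminormedAddCommGroup E] [NormedSpace ℂ E] extends
    PQSeminorm L E where
  underlying' : ∀ ξ η : L, ‖ξ‖ = 1 → ‖η‖ = 1 → ∀ x : E, toFun (rk ξ η ⊗ₜ[ℂ] x) = ‖x‖

variable {L}

/-- The function `u ↦ ‖u‖` on `K ⊗ E`. -/
def PQSeminorm.nm {E : Type*} [AddCommGroup E] [Module ℂ E] (A : PQSeminorm L E)
    (u : K L ⊗[ℂ] E) : ℝ := A.toSeminorm u

theorem PQSeminorm.nm_bimod {E : Type*} [AddCommGroup E] [Module ℂ E] (A : PQSeminorm L E)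
    (a b : L →L[ℂ] L) (u : K L ⊗[ℂ] E) : A.nm (bimod E a b u) ≤ ‖a‖ * A.nm u * ‖b‖ :=
  A.contractive' a b u

theorem PQSeminorm.nm_add {E : Type*} [AddCommGroup E] [Module ℂ E] (A : PQSeminorm L E)
    (u v : K L ⊗[ℂ] E) : A.nm (u + v) ≤ A.nm u + A.nm v := map_add_le_add A.toSeminorm u v

theorem PQSeminorm.nm_smul {E : Type*} [AddCommGroup E] [Module ℂ E] (A : PQSeminorm L E)
    (c : ℂ) (u : K L ⊗[ℂ] E) : A.nm (c • u) = ‖c‖ * A.nm u := map_smul_eq_mul A.toSeminorm c u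

theorem PQSeminorm.nm_nonneg {E : Type*} [AddCommGroup E] [Module ℂ E] (A : PQSeminorm L E)
    (u : K L ⊗[ℂ] E) : 0 ≤ A.nm u := apply_nonneg A.toSeminorm u

theorem PQSeminorm.nm_zero {E : Type*} [AddCommGroup E] [Module ℂ E] (A : PQSeminorm L E) :
    A.nm 0 = 0 := map_zero A.toSeminorm

variable {E : Type*} [SeminormedAddCommGroup E] [NormedSpace ℂ E]

/-- The norm `u ↦ ‖u‖` of a proto-quantum space, as a function on `K ⊗ E`. -/
def PQSpace.nm (A : PQSpace L E) (u : K L ⊗[ℂ] E) : ℝ := A.toPQSeminorm.nm u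

theorem PQSpace.nm_rk (A : PQSpace L E) (ξ η : L) (hξ : ‖ξ‖ = 1) (hη : ‖η‖ = 1) (x : E) :
    A.nm (rk ξ η ⊗ₜ[ℂ] x) = ‖x‖ := A.underlying' ξ η hξ hη x

theorem rk_smul (c d : ℂ) (ξ η : L) : rk (c • ξ) (d • η) = (c * star d) • rk ξ η := by
  refine K_ext fun x => ?_
  simp [op_rk, smul_smul, mul_comm]

theorem rk_eq_unit (ξ η : L) (hξ : ξ ≠ 0) (hη : η ≠ 0) : ∃ ξ' η' : L, ‖ξ'‖ = 1 ∧ ‖η'‖ = 1 ∧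
    rk ξ η = ((‖ξ‖ * ‖η‖ : ℝ) : ℂ) • rk ξ' η' := by
  refine ⟨((‖ξ‖⁻¹ : ℝ) : ℂ) • ξ, ((‖η‖⁻¹ : ℝ) : ℂ) • η, ?_, ?_, ?_⟩
  · simp [norm_smul, norm_ne_zero_iff.2 hξ]
  · simp [norm_smul, norm_ne_zero_iff.2 hη]
  · rw [rk_smul, smul_smul]
    have h1 := norm_ne_zero_iff.2 hξ
    have h2 := norm_ne_zero_iff.2 hη
    have h3 : ((‖ξ‖ * ‖η‖ : ℝ) : ℂ) * (((‖ξ‖⁻¹ : ℝ) : ℂ) * star ((‖η‖⁻¹ : ℝ) : ℂ)) = 1 := by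
      have : star ((‖η‖⁻¹ : ℝ) : ℂ) = ((‖η‖⁻¹ : ℝ) : ℂ) := Complex.conj_ofReal _
      rw [this]
      norm_cast
      field_simp
    rw [h3, one_smul]

theorem rk_zero_left (η : L) : rk (0 : L) η = 0 := K_ext fun _ => by simp [op_rk]

theorem rk_zero_right (ξ : L) : rk ξ (0 : L) = 0 := K_ext fun _ => by simp [op_rk]

theorem PQSpace.nm_rk' (A : PQSpace L E) (ξ η : L) (x : E) :
    A.nm (rk ξ η ⊗ₜ[ℂ] x) = ‖ξ‖ * ‖η‖ * ‖x‖ := by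
  by_cases hξ : ξ = 0
  · simp [hξ, rk_zero_left, PQSpace.nm, PQSeminorm.nm_zero]
  by_cases hη : η = 0
  · simp [hη, rk_zero_right, PQSpace.nm, PQSeminorm.nm_zero]
  obtain ⟨ξ', η', h1, h2, h⟩ := rk_eq_unit ξ η hξ hη
  rw [h, ← TensorProduct.smul_tmul', PQSpace.nm, PQSeminorm.nm_smul]
  change _ * A.nm _ = _
  rw [A.nm_rk ξ' η' h1 h2]
  simp

/-- `‖a ⊗ x‖ ≤ C ‖x‖` with `C` depending only on `a`. -/
theorem PQSpace.exists_bound [CompleteSpace L] (A : PQSpace L E) (a : K L) :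
    ∃ C : ℝ, ∀ x : E, A.nm (a ⊗ₜ[ℂ] x) ≤ C * ‖x‖ := by
  obtain ⟨n, ξ, η, rfl⟩ := exists_sum_rk a
  refine ⟨∑ i, ‖ξ i‖ * ‖η i‖, fun x => ?_⟩
  rw [TensorProduct.sum_tmul, Finset.sum_mul]
  simp_rw [← A.nm_rk']
  exact Finset.le_sum_of_subadditive A.nm A.nm_zero.le A.nm_add _ _

/-- The functional `a ↦ ⟨a η, ξ⟩` on `K`, tensored with the identity of `E`. -/
def slice (E : Type*) [AddCommGroup E] [Module ℂ E] (ξ η : L) : K L ⊗[ℂ] E →ₗ[ℂ] E :=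
  TensorProduct.lid ℂ E ∘ₗ LinearMap.rTensor E
    ((innerSL ℂ ξ : L →ₗ[ℂ] ℂ) ∘ₗ (ContinuousLinearMap.apply ℂ L η : (L →L[ℂ] L) →ₗ[ℂ] L) ∘ₗ op)

theorem slice_tmul (E : Type*) [AddCommGroup E] [Module ℂ E] (ξ η : L) (a : K L) (x : E) :
    slice E ξ η (a ⊗ₜ x) = inner ℂ ξ (op a η) • x := by
  simp [slice]

theorem bimod_rk_rk (E : Type*) [AddCommGroup E] [Module ℂ E] (ξ η : L)
    (u : K L ⊗[ℂ] E) :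
    bimod E (rankOne ℂ ξ ξ) (rankOne ℂ η η) u = rk ξ η ⊗ₜ slice E ξ η u := by
  induction u with
  | zero => simp
  | add u v hu hv => simp [hu, hv, TensorProduct.tmul_add]
  | tmul a x =>
    rw [slice_tmul, ← TensorProduct.smul_tmul, bimod, LinearMap.rTensor_tmul]
    congr 1
    refine K_ext fun y => ?_
    simp [op_sandwich, op_rk, smul_smul, mul_comm]

theorem eq_zero_of_slice (E : Type*) [AddCommGroup E] [Module ℂ E]
    (u : K L ⊗[ℂ] E) (h : ∀ ξ η : L, ‖ξ‖ = 1 → ‖η‖ = 1 → slice E ξ η u = 0) : u = 0 := by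
  classical
  let b := Module.Free.chooseBasis ℂ E
  apply (TensorProduct.equivFinsuppOfBasisRight b (M := K L)).injective
  rw [map_zero]
  have key : ∀ (ξ η : L) (i) (v : K L ⊗[ℂ] E), b.repr (slice E ξ η v) i =
      inner ℂ ξ (op (TensorProduct.equivFinsuppOfBasisRight b v i) η) := by
    intro ξ η i v
    induction v with
    | zero => simp
    | add u v hu hv => simp [hu, hv]
    | tmul a x => simp [slice_tmul, mul_comm]
  ext i : 1
  refine K_ext fun η => ?_
  set T := TensorProduct.equivFinsuppOfBasisRight b u i
  have h0 : ∀ ξ η : L, ‖ξ‖ = 1 → ‖η‖ = 1 → inner ℂ ξ (op T η) = (0 : ℂ) := by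
    intro ξ η h1 h2
    rw [← key, h ξ η h1 h2]; simp
  rw [Finsupp.coe_zero, Pi.zero_apply, map_zero, zero_apply]
  by_contra hne
  have hη : η ≠ 0 := by rintro rfl; simp at hne
  have := h0 (((‖op T η‖⁻¹ : ℝ) : ℂ) • op T η) (((‖η‖⁻¹ : ℝ) : ℂ) • η)
    (by simp [norm_smul, norm_ne_zero_iff.2 hne]) (by simp [norm_smul, norm_ne_zero_iff.2 hη])
  rw [map_smul, inner_smul_left, inner_smul_right, mul_eq_zero, mul_eq_zero] at this
  simp [hne, hη] at this

/-- If the underlying space is normed, the semi-norm on `K ⊗ E` is a norm. -/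
theorem PQSpace.eq_zero {E : Type*} [NormedAddCommGroup E] [NormedSpace ℂ E] (A : PQSpace L E)
    (u : K L ⊗[ℂ] E) (h : A.nm u = 0) : u = 0 := by
  refine eq_zero_of_slice E u fun ξ η hξ hη => ?_
  have h1 := A.nm_bimod (rankOne ℂ ξ ξ) (rankOne ℂ η η) u
  rw [bimod_rk_rk] at h1
  change A.nm _ ≤ _ * A.nm u * _ at h1
  rw [A.nm_rk ξ η hξ hη, h] at h1
  simpa using h1

/-- The amplification `K ⊗ E` of a proto-quantum space, as a (semi-)normed space. -/
def Amp (_A : PQSpace L E) : Type _ := K L ⊗[ℂ] E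

namespace Amp

variable (A : PQSpace L E)

instance : AddCommGroup (Amp A) := inferInstanceAs (AddCommGroup (K L ⊗[ℂ] E))

instance : Module ℂ (Amp A) := inferInstanceAs (Module ℂ (K L ⊗[ℂ] E))

/-- The identity map `K ⊗ E → Amp A`. -/
def of : K L ⊗[ℂ] E ≃ₗ[ℂ] Amp A := LinearEquiv.refl ℂ _

instance : SeminormedAddCommGroup (Amp A) :=
  AddGroupSeminorm.toSeminormedAddCommGroup
    (E := Amp A)
    { toFun := fun u => A.nm ((of A).symm u)
      map_zero' := A.nm_zero
      add_le' := fun u v => A.nm_add u v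
      neg' := fun u => map_neg_eq_map A.toSeminorm ((of A).symm u) }

theorem norm_of (u : K L ⊗[ℂ] E) : ‖of A u‖ = A.nm u := rfl

theorem norm_def (u : Amp A) : ‖u‖ = A.nm ((of A).symm u) := rfl

instance : NormedSpace ℂ (Amp A) where
  norm_smul_le c u := (A.nm_smul c ((of A).symm u)).le

instance instNormed {E : Type*} [NormedAddCommGroup E] [NormedSpace ℂ E] (A : PQSpace L E) :
    NormedAddCommGroup (Amp A) :=
  NormedAddCommGroup.ofSeparation fun u h => A.eq_zero u h

/-- The bounded operator `x ↦ a ⊗ x`. -/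
def tmulL [CompleteSpace L] (a : K L) : E →L[ℂ] Amp A :=
  LinearMap.mkContinuousOfExistsBound
    ((of A).toLinearMap ∘ₗ TensorProduct.mk ℂ (K L) E a) (A.exists_bound a)

theorem tmulL_apply [CompleteSpace L] (a : K L) (x : E) : tmulL A a x = of A (a ⊗ₜ x) := rfl

theorem tmulL_add [CompleteSpace L] (a b : K L) : tmulL A (a + b) = tmulL A a + tmulL A b := by
  ext x
  simp [tmulL_apply, TensorProduct.add_tmul]

theorem tmulL_smul [CompleteSpace L] (c : ℂ) (a : K L) : tmulL A (c • a) = c • tmulL A a := rfl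

/-- The bounded operator `u ↦ a · u · b`. -/
def bimodL (a b : L →L[ℂ] L) : Amp A →L[ℂ] Amp A :=
  LinearMap.mkContinuous ((of A).toLinearMap ∘ₗ bimod E a b ∘ₗ (of A).symm.toLinearMap)
    (‖a‖ * ‖b‖) (fun u => (A.nm_bimod a b ((of A).symm u)).trans_eq (by
      rw [norm_def]; change ‖a‖ * A.nm _ * ‖b‖ = _; ring))

theorem bimodL_of (a b : L →L[ℂ] L) (u : K L ⊗[ℂ] E) :
    bimodL A a b (of A u) = of A (bimod E a b u) := rfl

theorem norm_bimodL_le (a b : L →L[ℂ] L) : ‖bimodL A a b‖ ≤ ‖a‖ * ‖b‖ :=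
  LinearMap.mkContinuous_norm_le _ (by positivity) _

end Amp

/-- `A` is `p`-convex: `‖∑ u_k‖ ≤ (∑ ‖u_k‖ ^ p) ^ (1 / p)` (the maximum if `p = ∞`) whenever the
`u_k` have pairwise orthogonal supports. A projection `P` is a support of `u` if `P · u · P = u`. -/
def PQSpace.IsConvex [CompleteSpace L] (A : PQSpace L E) (p : ℝ≥0∞) : Prop :=
  ∀ (n : ℕ) (u : Fin n → K L ⊗[ℂ] E) (P : Fin n → (L →L[ℂ] L)),
    (∀ k, IsStarProjection (P k)) → (∀ j k, j ≠ k → P j ∘L P k = 0) →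
    (∀ k, bimod E (P k) (P k) (u k) = u k) →
    A.nm (∑ k, u k) ≤ ‖WithLp.toLp p (fun k => A.nm (u k))‖

/-- A linear isomorphism is completely isometric if its amplification is isometric. -/
def IsCompletelyIsometric {F : Type*} [SeminormedAddCommGroup F] [NormedSpace ℂ F]
    (A : PQSpace L E) (B : PQSpace L F) (f : E ≃ₗ[ℂ] F) : Prop :=
  ∀ u : K L ⊗[ℂ] E, B.nm (f.toLinearMap.lTensor (K L) u) = A.nm u

end Spaces

section L1

variable {L : Type*} [NormedAddCommGroup L] [InnerProductSpace ℂ L] [CompleteSpace L]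
variable {X : Type*} [MeasurableSpace X] (μ : Measure X)
variable {E : Type*} [NormedAddCommGroup E] [NormedSpace ℂ E]

/-- The operator `α : K ⊗ L₁(X, E) → L₁(X, K ⊗ E)`, which takes `a ⊗ x` to the function
`t ↦ a ⊗ x(t)`. -/
def alpha (A : PQSpace L E) : K L ⊗[ℂ] Lp E 1 μ →ₗ[ℂ] Lp (Amp A) 1 μ :=
  TensorProduct.lift
    { toFun := fun a => ((Amp.tmulL A a).compLpL 1 μ).toLinearMap
      map_add' := fun a b => by rw [Amp.tmulL_add, ContinuousLinearMap.add_compLpL]; rfl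
      map_smul' := fun c a => by rw [Amp.tmulL_smul, ContinuousLinearMap.smul_compLpL]; rfl }

theorem alpha_tmul (A : PQSpace L E) (a : K L) (x : Lp E 1 μ) :
    alpha μ A (a ⊗ₜ x) = (Amp.tmulL A a).compLpL 1 μ x := rfl

theorem alpha_bimod (A : PQSpace L E) (a b : L →L[ℂ] L) (u : K L ⊗[ℂ] Lp E 1 μ) :
    alpha μ A (bimod _ a b u) = (Amp.bimodL A a b).compLpL 1 μ (alpha μ A u) := by
  induction u with
  | zero => simp
  | add u v hu hv => simp [hu, hv]
  | tmul k x =>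
    rw [bimod, LinearMap.rTensor_tmul, alpha_tmul, alpha_tmul]
    apply Lp.ext
    filter_upwards [(Amp.tmulL A (sandwich a b k)).coeFn_compLpL (p := 1) (μ := μ) x,
      (Amp.tmulL A k).coeFn_compLpL (p := 1) (μ := μ) x,
      (Amp.bimodL A a b).coeFn_compLpL (p := 1) (μ := μ) ((Amp.tmulL A k).compLpL 1 μ x)]
      with t h1 h2 h3
    rw [h1, h3, h2]
    rfl

/-- The standard proto-quantization of `L₁(X, E)`, with the norm `‖u‖ = ‖α(u)‖`. -/
def PQSpace.L1 (A : PQSpace L E) : PQSpace L (Lp E 1 μ) where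
  toSeminorm := (normSeminorm ℂ (Lp (Amp A) 1 μ)).comp (alpha μ A)
  contractive' a b u := by
    change ‖alpha μ A (bimod _ a b u)‖ ≤ ‖a‖ * ‖alpha μ A u‖ * ‖b‖
    rw [alpha_bimod]
    refine ((Amp.bimodL A a b).norm_compLp_le _).trans ?_
    refine (mul_le_mul_of_nonneg_right (Amp.norm_bimodL_le A a b) (norm_nonneg _)).trans_eq ?_
    ring
  underlying' ξ η hξ hη x := by
    change ‖alpha μ A (rk ξ η ⊗ₜ x)‖ = ‖x‖
    rw [alpha_tmul]
    have : ∀ᵐ t ∂μ, ‖((Amp.tmulL A (rk ξ η)).compLpL 1 μ x) t‖ = ‖x t‖ := by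
      filter_upwards [(Amp.tmulL A (rk ξ η)).coeFn_compLpL (p := 1) (μ := μ) x] with t h1
      rw [h1, Amp.tmulL_apply, Amp.norm_of, A.nm_rk ξ η hξ hη]
    exact le_antisymm (Lp.norm_le_norm_of_ae_le (this.mono fun t h => h.le))
      (Lp.norm_le_norm_of_ae_le (this.mono fun t h => h.ge))

end L1

section Completion

variable {L : Type*} [NormedAddCommGroup L] [InnerProductSpace ℂ L] [CompleteSpace L]
variable {E : Type*} [SeminormedAddCommGroup E] [NormedSpace ℂ E]

open UniformSpace (Completion)

theorem completion_add_apply {G : Type*} [SeminormedAddCommGroup G] [NormedSpace ℂ G]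
    (f g : E →L[ℂ] G) (x : Completion E) :
    (f + g).completion x = f.completion x + g.completion x := by
  induction x using Completion.induction_on with
  | hp => exact isClosed_eq (by fun_prop) (by fun_prop)
  | ih x => simp [Completion.coe_add]

theorem completion_smul_apply {G : Type*} [SeminormedAddCommGroup G] [NormedSpace ℂ G]
    (c : ℂ) (f : E →L[ℂ] G) (x : Completion E) :
    (c • f).completion x = c • f.completion x := by
  induction x using Completion.induction_on with
  | hp => exact isClosed_eq (by fun_prop) ((ContinuousLinearMap.continuous _).const_smul c)
  | ih x => simp [Completion.coe_smul]

/-- The natural operator from `K ⊗ Ē` to the completion of `K ⊗ E`, where `Ē` is the completion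
of `E`; it takes `a ⊗ x` with `x ∈ E` to `a ⊗ x`. -/
def gamma (A : PQSpace L E) : K L ⊗[ℂ] Completion E →ₗ[ℂ] Completion (Amp A) :=
  TensorProduct.lift
    { toFun := fun a => (Amp.tmulL A a).completion.toLinearMap
      map_add' := fun a b => LinearMap.ext fun x => by
        rw [Amp.tmulL_add]
        exact completion_add_apply _ _ x
      map_smul' := fun c a => LinearMap.ext fun x => by
        rw [Amp.tmulL_smul]
        exact completion_smul_apply c _ x }

theorem gamma_tmul (A : PQSpace L E) (a : K L) (x : Completion E) :
    gamma A (a ⊗ₜ x) = (Amp.tmulL A a).completion x := rfl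

theorem gamma_bimod (A : PQSpace L E) (a b : L →L[ℂ] L) (u : K L ⊗[ℂ] Completion E) :
    gamma A (bimod _ a b u) = (Amp.bimodL A a b).completion (gamma A u) := by
  induction u with
  | zero => simp
  | add u v hu hv => simp [hu, hv]
  | tmul k x =>
    rw [bimod, LinearMap.rTensor_tmul, gamma_tmul, gamma_tmul]
    induction x using Completion.induction_on with
    | hp => exact isClosed_eq (by fun_prop) (by fun_prop)
    | ih x =>
      simp only [ContinuousLinearMap.completion_apply_coe]
      rfl

/-- The completion of a proto-quantum space: the norm on `K ⊗ Ē` is induced from the completion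
of `K ⊗ E`. -/
def PQSpace.completion (A : PQSpace L E) : PQSpace L (Completion E) where
  toSeminorm := (normSeminorm ℂ (Completion (Amp A))).comp (gamma A)
  contractive' a b u := by
    change ‖gamma A (bimod _ a b u)‖ ≤ ‖a‖ * ‖gamma A u‖ * ‖b‖
    rw [gamma_bimod]
    generalize gamma A u = w
    induction w using Completion.induction_on with
    | hp => exact isClosed_le (by fun_prop) (by fun_prop)
    | ih w =>
      rw [ContinuousLinearMap.completion_apply_coe, Completion.norm_coe, Completion.norm_coe]
      refine ((Amp.bimodL A a b).le_opNorm w).trans ?_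
      refine (mul_le_mul_of_nonneg_right (Amp.norm_bimodL_le A a b) (norm_nonneg _)).trans_eq ?_
      ring
  underlying' ξ η hξ hη x := by
    change ‖gamma A (rk ξ η ⊗ₜ x)‖ = ‖x‖
    rw [gamma_tmul]
    induction x using Completion.induction_on with
    | hp => exact isClosed_eq (by fun_prop) (by fun_prop)
    | ih x =>
      rw [ContinuousLinearMap.completion_apply_coe, Completion.norm_coe, Completion.norm_coe,
        Amp.tmulL_apply, Amp.norm_of, A.nm_rk ξ η hξ hη]

end Completion

section Schatten

variable {L : Type*} [NormedAddCommGroup L] [InnerProductSpace ℂ L]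

/-- `a = ∑ s_k ξ_k ∘ η_k` is a singular value decomposition of `a`: the `ξ_k` and the `η_k` are
orthonormal and `s_k ≥ 0`. -/
structure IsSVD (a : K L) {n : ℕ} (s : Fin n → ℝ) (ξ η : Fin n → L) : Prop where
  left : Orthonormal ℂ ξ
  right : Orthonormal ℂ η
  nonneg : ∀ k, 0 ≤ s k
  eq : a = ∑ k, (s k : ℂ) • rk (ξ k) (η k)

/-- The `p`-th Schatten norm `(∑ s_k ^ p) ^ (1 / p)` (the maximum of the `s_k` if `p = ∞`), where
`a = ∑ s_k ξ_k ∘ η_k` is a singular value decomposition. All singular value decompositions of `a`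
give the same value, see `schatten_eq` below. -/
def schatten (p : ℝ≥0∞) (a : K L) : ℝ :=
  sInf {r | ∃ (n : ℕ) (s : Fin n → ℝ) (ξ η : Fin n → L), IsSVD a s ξ η ∧ r = ‖WithLp.toLp p s‖}

/-- A square function bound `∑ |⟨e_k, x⟩|² ≤ C² ‖x‖²` (Bessel's inequality with a constant). -/
def IsBessel {n : ℕ} (e : Fin n → L) (C : ℝ) : Prop :=
  0 ≤ C ∧ ∀ x : L, ∑ k, ‖inner ℂ (e k) x‖ ^ 2 ≤ C ^ 2 * ‖x‖ ^ 2

theorem isBessel_of_orthonormal {n : ℕ} {e : Fin n → L} (h : Orthonormal ℂ e) : IsBessel e 1 :=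
  ⟨zero_le_one, fun x => by simpa using h.sum_inner_products_le x (s := Finset.univ)⟩

theorem IsBessel.map [CompleteSpace L] {n : ℕ} {e : Fin n → L} (h : IsBessel e 1)
    (d : L →L[ℂ] L) : IsBessel (fun k => d (e k)) ‖d‖ := by
  refine ⟨norm_nonneg d, fun x => ?_⟩
  have h1 := h.2 (d.adjoint x)
  simp only [ContinuousLinearMap.adjoint_inner_right] at h1
  refine h1.trans ?_
  rw [one_pow, one_mul, ← mul_pow]
  gcongr
  exact (d.adjoint.le_opNorm x).trans_eq (by rw [LinearIsometryEquiv.norm_map])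

theorem IsBessel.norm_le {n : ℕ} {e : Fin n → L} {C : ℝ} (h : IsBessel e C) (k : Fin n) :
    ‖e k‖ ≤ C := by
  by_cases h0 : ‖e k‖ = 0
  · rw [h0]; exact h.1
  have h1 : ‖inner ℂ (e k) (e k)‖ ^ 2 ≤ C ^ 2 * ‖e k‖ ^ 2 :=
    (Finset.single_le_sum (f := fun j => ‖inner ℂ (e j) (e k)‖ ^ 2)
      (fun _ _ => by positivity) (Finset.mem_univ k)).trans (h.2 (e k))
  have h2 : ‖inner ℂ (e k) (e k)‖ = ‖e k‖ ^ 2 := by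
    rw [inner_self_eq_norm_sq_to_K]; simp
  rw [h2] at h1
  have hp : 0 < ‖e k‖ ^ 2 := by positivity
  have h3 : ‖e k‖ ^ 2 ≤ C ^ 2 := by nlinarith
  exact (sq_le_sq₀ (norm_nonneg _) h.1).1 h3

/-- Cauchy–Schwarz for two Bessel families. -/
theorem IsBessel.sum_mul_le {n : ℕ} {e f : Fin n → L} {C D : ℝ} (he : IsBessel e C)
    (hf : IsBessel f D) (x y : L) :
    ∑ k, ‖inner ℂ (e k) x‖ * ‖inner ℂ (f k) y‖ ≤ (C * ‖x‖) * (D * ‖y‖) := by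
  have h := Finset.sum_mul_sq_le_sq_mul_sq Finset.univ (fun k => ‖inner ℂ (e k) x‖)
    (fun k => ‖inner ℂ (f k) y‖)
  have hC := he.1
  have hD := hf.1
  refine abs_le_of_sq_le_sq' ?_ (by positivity) |>.2
  refine h.trans ?_
  rw [mul_pow]
  refine mul_le_mul ?_ ?_ (Finset.sum_nonneg fun _ _ => by positivity) (by positivity)
  · rw [mul_pow]; exact he.2 x
  · rw [mul_pow]; exact hf.2 y

/-- A matrix with nonnegative entries whose rows and columns have sums at most `M` acts on `ℓ_p`
with norm at most `M`. -/
theorem schur_bound {p : ℝ≥0∞} [Fact (1 ≤ p)] {m n : ℕ} (w : Fin m → Fin n → ℝ)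
    (hw : ∀ k j, 0 ≤ w k j) {M : ℝ} (hM : 0 ≤ M) (hrow : ∀ k, ∑ j, w k j ≤ M)
    (hcol : ∀ j, ∑ k, w k j ≤ M) (s : Fin n → ℝ) (hs : ∀ j, 0 ≤ s j) (c : Fin m → ℂ)
    (hc : ∀ k, ‖c k‖ ≤ ∑ j, w k j * s j) :
    ‖WithLp.toLp p c‖ ≤ M * ‖WithLp.toLp p s‖ := by
  by_cases hp : p = ∞
  · subst hp
    rw [PiLp.norm_eq_ciSup, PiLp.norm_eq_ciSup]
    refine Real.iSup_le (fun k => ?_) (mul_nonneg hM (Real.iSup_nonneg fun j => norm_nonneg _))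
    refine (hc k).trans ?_
    have hj : ∀ j, s j ≤ ⨆ i, ‖s i‖ := fun j =>
      (le_abs_self _).trans (le_ciSup (f := fun i => ‖s i‖) (Set.finite_range _).bddAbove j)
    calc ∑ j, w k j * s j ≤ ∑ j, w k j * ⨆ i, ‖s i‖ :=
          Finset.sum_le_sum fun j _ => mul_le_mul_of_nonneg_left (hj j) (hw k j)
      _ = (∑ j, w k j) * ⨆ i, ‖s i‖ := by rw [Finset.sum_mul]
      _ ≤ _ := mul_le_mul_of_nonneg_right (hrow k) (Real.iSup_nonneg fun j => norm_nonneg _)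
  · have hp1 : 1 ≤ p.toReal := by
      have := ENNReal.toReal_mono hp (Fact.out : 1 ≤ p)
      simpa using this
    have hp0 : 0 < p.toReal := by linarith
    rw [PiLp.norm_eq_sum hp0, PiLp.norm_eq_sum hp0]
    set q := p.toReal
    simp only
    have h1 : ∀ k, ‖c k‖ ^ q ≤ M ^ (q - 1) * ∑ j, w k j * s j ^ q := by
      intro k
      have hS : 0 ≤ ∑ j, w k j * s j ^ q :=
        Finset.sum_nonneg fun j _ => mul_nonneg (hw k j) (Real.rpow_nonneg (hs j) _)
      have hR : 0 ≤ ∑ j, w k j := Finset.sum_nonneg fun j _ => hw k j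
      have h2 := (hc k).trans
        (Real.inner_le_weight_mul_Lp_of_nonneg Finset.univ hp1 (w k) s (hw k) hs)
      have h3 : (∑ j, w k j) ^ (1 - q⁻¹) ≤ M ^ (1 - q⁻¹) :=
        Real.rpow_le_rpow hR (hrow k) (sub_nonneg.2 (inv_le_one_of_one_le₀ hp1))
      have h4 := h2.trans (mul_le_mul_of_nonneg_right h3 (Real.rpow_nonneg hS _))
      have h5 := Real.rpow_le_rpow (norm_nonneg _) h4 hp0.le
      rw [Real.mul_rpow (Real.rpow_nonneg hM _) (Real.rpow_nonneg hS _), ← Real.rpow_mul hM,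
        ← Real.rpow_mul hS, inv_mul_cancel₀ hp0.ne', Real.rpow_one] at h5
      convert h5 using 3
      field_simp
    have h6 : ∑ k, ‖c k‖ ^ q ≤ M ^ q * ∑ j, ‖s j‖ ^ q := by
      calc ∑ k, ‖c k‖ ^ q ≤ ∑ k, M ^ (q - 1) * ∑ j, w k j * s j ^ q :=
            Finset.sum_le_sum fun k _ => h1 k
        _ = M ^ (q - 1) * ∑ j, (∑ k, w k j) * s j ^ q := by
            rw [← Finset.mul_sum, Finset.sum_comm]
            simp_rw [Finset.sum_mul]
        _ ≤ M ^ (q - 1) * ∑ j, M * s j ^ q := by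
            refine mul_le_mul_of_nonneg_left ?_ (Real.rpow_nonneg hM _)
            exact Finset.sum_le_sum fun j _ =>
              mul_le_mul_of_nonneg_right (hcol j) (Real.rpow_nonneg (hs j) _)
        _ = (M ^ (q - 1) * M) * ∑ j, ‖s j‖ ^ q := by
            rw [← Finset.mul_sum, mul_assoc]
            simp_rw [Real.norm_of_nonneg (hs _)]
        _ = M ^ q * ∑ j, ‖s j‖ ^ q := by
            congr 1
            rcases hM.eq_or_lt with h0 | h0
            · rw [← h0, mul_zero, Real.zero_rpow hp0.ne']
            · rw [Real.rpow_sub_one h0.ne', div_mul_cancel₀ _ h0.ne']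
    have hS : 0 ≤ ∑ j, ‖s j‖ ^ q := Finset.sum_nonneg fun j _ => by positivity
    refine (Real.rpow_le_rpow (Finset.sum_nonneg fun k _ => by positivity) h6
      (by positivity)).trans_eq ?_
    rw [Real.mul_rpow (by positivity) hS, ← Real.rpow_mul hM, mul_one_div, div_self hp0.ne',
      Real.rpow_one]

/-- The matrix coefficients of `a` with respect to two Bessel families. -/
theorem IsSVD.bound {p : ℝ≥0∞} [Fact (1 ≤ p)] {a : K L} {n : ℕ} {s : Fin n → ℝ} {ξ η : Fin n → L}
    (h : IsSVD a s ξ η) {m : ℕ} {e f : Fin m → L} {C D : ℝ} (he : IsBessel e C)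
    (hf : IsBessel f D) :
    ‖WithLp.toLp p (fun k => inner ℂ (e k) (op a (f k)))‖ ≤ C * D * ‖WithLp.toLp p s‖ := by
  refine schur_bound (fun k j => ‖inner ℂ (e k) (ξ j)‖ * ‖inner ℂ (f k) (η j)‖)
    (fun k j => by positivity) (mul_nonneg he.1 hf.1) (fun k => ?_) (fun j => ?_) s h.nonneg _
    (fun k => ?_)
  · have h1 := (isBessel_of_orthonormal h.left).sum_mul_le (isBessel_of_orthonormal h.right)
      (e k) (f k)
    simp only [one_mul, norm_inner_symm _ (e k), norm_inner_symm _ (f k)] at h1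
    exact h1.trans (mul_le_mul (he.norm_le k) (hf.norm_le k) (norm_nonneg _) he.1)
  · have h1 := he.sum_mul_le hf (ξ j) (η j)
    rwa [h.left.1 j, h.right.1 j, mul_one, mul_one] at h1
  · rw [h.eq]
    simp only [map_sum, map_smul, op_rk, sum_apply, smul_apply, rankOne_apply, inner_sum,
      inner_smul_right]
    refine (norm_sum_le _ _).trans (Finset.sum_le_sum fun j _ => le_of_eq ?_)
    rw [norm_mul, norm_mul, Complex.norm_real, Real.norm_of_nonneg (h.nonneg j),
      norm_inner_symm (η j)]
    ring

theorem IsSVD.coeff {a : K L} {n : ℕ} {s : Fin n → ℝ} {ξ η : Fin n → L} (h : IsSVD a s ξ η)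
    (k : Fin n) : inner ℂ (ξ k) (op a (η k)) = (s k : ℂ) := by
  rw [h.eq]
  simp only [map_sum, map_smul, op_rk, sum_apply, smul_apply, rankOne_apply, inner_sum,
      inner_smul_right, orthonormal_iff_ite.1 h.left, orthonormal_iff_ite.1 h.right]
  simp

theorem norm_toLp_ofReal (p : ℝ≥0∞) [Fact (1 ≤ p)] {n : ℕ} (s : Fin n → ℝ) :
    ‖WithLp.toLp p (fun k => (s k : ℂ))‖ = ‖WithLp.toLp p s‖ := by
  by_cases hp : p = ∞
  · subst hp
    simp [PiLp.norm_eq_ciSup]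
  · have hp0 : 0 < p.toReal := ENNReal.toReal_pos
      (zero_lt_one.trans_le (Fact.out : 1 ≤ p)).ne' hp
    simp [PiLp.norm_eq_sum hp0]

theorem IsSVD.norm_eq {p : ℝ≥0∞} [Fact (1 ≤ p)] {a : K L} {n : ℕ} {s : Fin n → ℝ}
    {ξ η : Fin n → L} (h : IsSVD a s ξ η) :
    ‖WithLp.toLp p s‖ = ‖WithLp.toLp p (fun k => inner ℂ (ξ k) (op a (η k)))‖ := by
  simp_rw [h.coeff, norm_toLp_ofReal]

theorem IsSVD.norm_unique {p : ℝ≥0∞} [Fact (1 ≤ p)] {a : K L} {n m : ℕ} {s : Fin n → ℝ}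
    {ξ η : Fin n → L} (h : IsSVD a s ξ η) {s' : Fin m → ℝ} {ξ' η' : Fin m → L}
    (h' : IsSVD a s' ξ' η') : ‖WithLp.toLp p s‖ = ‖WithLp.toLp p s'‖ := by
  refine le_antisymm ?_ ?_
  · rw [h.norm_eq]
    simpa using h'.bound (p := p) (isBessel_of_orthonormal h.left)
      (isBessel_of_orthonormal h.right)
  · rw [h'.norm_eq]
    simpa using h.bound (p := p) (isBessel_of_orthonormal h'.left)
      (isBessel_of_orthonormal h'.right)

theorem schatten_eq {p : ℝ≥0∞} [Fact (1 ≤ p)] {a : K L} {n : ℕ} {s : Fin n → ℝ}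
    {ξ η : Fin n → L} (h : IsSVD a s ξ η) : schatten p a = ‖WithLp.toLp p s‖ := by
  have : {r | ∃ (n : ℕ) (s : Fin n → ℝ) (ξ η : Fin n → L), IsSVD a s ξ η ∧
      r = ‖WithLp.toLp p s‖} = {‖WithLp.toLp p s‖} := by
    ext r
    constructor
    · rintro ⟨m, s', ξ', η', h', rfl⟩
      exact h'.norm_unique h
    · rintro rfl
      exact ⟨n, s, ξ, η, h, rfl⟩
  rw [schatten, this, csInf_singleton]

variable [CompleteSpace L]

/-- Every operator of finite rank has a singular value decomposition. -/
theorem exists_isSVD (a : K L) : ∃ (n : ℕ) (s : Fin n → ℝ) (ξ η : Fin n → L), IsSVD a s ξ η := by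
  obtain ⟨n, ξ₀, η₀, ha⟩ := exists_sum_rk a
  let V : Submodule ℂ L := Submodule.span ℂ (Set.range η₀)
  have hV : FiniteDimensional ℂ V := FiniteDimensional.span_of_finite ℂ (Set.finite_range η₀)
  -- `a` vanishes on the orthogonal complement of `V`
  have hproj : ∀ x, op a x = op a (V.orthogonalProjectionOnto x : L) := by
    intro x
    rw [ha]
    simp only [map_sum, op_rk, sum_apply, rankOne_apply]
    refine Finset.sum_congr rfl fun i _ => ?_
    congr 1
    have hi : η₀ i ∈ V := Submodule.subset_span ⟨i, rfl⟩
    have := V.inner_orthogonalProjectionOnto_eq_of_mem_left ⟨η₀ i, hi⟩ x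
    exact this.symm
  let T : V →ₗ[ℂ] V := (V.orthogonalProjectionOnto : L →ₗ[ℂ] V) ∘ₗ
    (((op a).adjoint ∘L op a : L →L[ℂ] L) : L →ₗ[ℂ] L) ∘ₗ V.subtype
  have hTinner : ∀ x y : V, inner ℂ (T x) y = inner ℂ (op a x) (op a y) := by
    intro x y
    have h1 : inner ℂ (T x) y = inner ℂ ((op a).adjoint (op a x)) (y : L) :=
      V.inner_orthogonalProjectionOnto_eq_of_mem_right y _
    rw [h1, ContinuousLinearMap.adjoint_inner_left]
  have hT : T.IsSymmetric := by
    intro x y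
    rw [hTinner, ← inner_conj_symm x, hTinner, inner_conj_symm]
  let b := hT.eigenvectorBasis rfl
  have horth : ∀ i j, i ≠ j → inner ℂ (op a (b i)) (op a (b j)) = (0 : ℂ) := by
    intro i j hij
    rw [← hTinner, hT.apply_eigenvectorBasis, inner_smul_left,
      orthonormal_iff_ite.1 b.orthonormal i j, if_neg hij, mul_zero]
  have hsum : a = ∑ i, rk (op a (b i)) (b i : L) := by
    refine K_ext fun x => ?_
    rw [hproj x, b.orthogonalProjectionOnto_eq_sum_rankOne]
    simp [op_rk]
  classical
  let J := {i // op a (b i : L) ≠ 0}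
  let φ : Fin (Fintype.card J) ≃ J := (Fintype.equivFin J).symm
  refine ⟨Fintype.card J, fun k => ‖op a (b (φ k).1)‖,
    fun k => ((‖op a (b (φ k).1)‖⁻¹ : ℝ) : ℂ) • op a (b (φ k).1), fun k => b (φ k).1, ?_, ?_,
    fun k => norm_nonneg _, ?_⟩
  · refine ⟨fun k => ?_, fun k l hkl => ?_⟩
    · rw [norm_smul, Complex.norm_real, norm_inv, norm_norm,
        inv_mul_cancel₀ (norm_ne_zero_iff.2 (φ k).2)]
    · beta_reduce
      rw [inner_smul_left, inner_smul_right,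
        horth _ _ (fun h => hkl (φ.injective (Subtype.ext h))), mul_zero, mul_zero]
  · have h1 : Orthonormal ℂ (fun i => (b i : L)) :=
      b.orthonormal.comp_linearIsometry V.subtypeₗᵢ
    exact h1.comp _ (Subtype.val_injective.comp φ.injective)
  · have h2 : ∀ k, ((‖op a (b (φ k).1 : L)‖ : ℝ) : ℂ) •
        rk (((‖op a (b (φ k).1 : L)‖⁻¹ : ℝ) : ℂ) • op a (b (φ k).1 : L)) (b (φ k).1 : L) =
        rk (op a (b (φ k).1 : L)) (b (φ k).1 : L) := by
      intro k
      have h3 := rk_smul (((‖op a (b (φ k).1 : L)‖⁻¹ : ℝ) : ℂ)) 1 (op a (b (φ k).1 : L))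
        (b (φ k).1 : L)
      rw [one_smul, star_one, mul_one] at h3
      rw [h3, smul_smul, ← Complex.ofReal_mul, mul_inv_cancel₀ (norm_ne_zero_iff.2 (φ k).2),
        Complex.ofReal_one, one_smul]
    rw [Finset.sum_congr rfl fun k _ => h2 k,
      φ.sum_comp (fun i : J => rk (op a (b i.1 : L)) (b i.1 : L))]
    conv_lhs => rw [hsum]
    refine (Finset.sum_subtype (Finset.univ.filter fun i => op a (b i : L) ≠ 0) (by simp)
      (fun i => rk (op a (b i : L)) (b i : L))).symm.trans ?_ |>.symm
    refine Finset.sum_filter_of_ne fun i _ hi h0 => hi ?_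
    rw [h0, rk_zero_left]

variable (p : ℝ≥0∞) [Fact (1 ≤ p)]

theorem schatten_le {b : K L} {r : ℝ}
    (h : ∀ {n : ℕ} (s : Fin n → ℝ) (ξ η : Fin n → L), IsSVD b s ξ η →
      ‖WithLp.toLp p (fun k => inner ℂ (ξ k) (op b (η k)))‖ ≤ r) : schatten p b ≤ r := by
  obtain ⟨n, s, ξ, η, hb⟩ := exists_isSVD b
  rw [schatten_eq hb, hb.norm_eq]
  exact h s ξ η hb

theorem coeff_le_schatten (a : K L) {m : ℕ} {e f : Fin m → L} {C D : ℝ} (he : IsBessel e C)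
    (hf : IsBessel f D) :
    ‖WithLp.toLp p (fun k => inner ℂ (e k) (op a (f k)))‖ ≤ C * D * schatten p a := by
  obtain ⟨n, s, ξ, η, ha⟩ := exists_isSVD a
  rw [schatten_eq ha]
  exact ha.bound he hf

theorem schatten_add (a b : K L) : schatten p (a + b) ≤ schatten p a + schatten p b := by
  refine schatten_le p fun s ξ η h => ?_
  have h1 := coeff_le_schatten p a (isBessel_of_orthonormal h.left)
    (isBessel_of_orthonormal h.right)
  have h2 := coeff_le_schatten p b (isBessel_of_orthonormal h.left)
    (isBessel_of_orthonormal h.right)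
  rw [one_mul, one_mul] at h1 h2
  have h3 : WithLp.toLp p (fun k => inner ℂ (ξ k) (op (a + b) (η k))) =
      WithLp.toLp p (fun k => inner ℂ (ξ k) (op a (η k))) +
      WithLp.toLp p (fun k => inner ℂ (ξ k) (op b (η k))) := by
    ext k
    simp
  rw [h3]
  exact (norm_add_le _ _).trans (add_le_add h1 h2)

theorem schatten_sandwich (c d : L →L[ℂ] L) (a : K L) :
    schatten p (sandwich c d a) ≤ ‖c‖ * schatten p a * ‖d‖ := by
  refine schatten_le p fun s ξ η h => ?_
  have h1 := coeff_le_schatten p a ((isBessel_of_orthonormal h.left).map c.adjoint)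
    ((isBessel_of_orthonormal h.right).map d)
  simp only [ContinuousLinearMap.adjoint_inner_left, LinearIsometryEquiv.norm_map] at h1
  exact h1.trans_eq (by ring)

theorem schatten_smul_le (c : ℂ) (a : K L) : schatten p (c • a) ≤ ‖c‖ * schatten p a := by
  have h : c • a = sandwich (c • ContinuousLinearMap.id ℂ L) (ContinuousLinearMap.id ℂ L) a :=
    K_ext fun x => by simp [op_sandwich]
  rw [h]
  have h0 : 0 ≤ ‖c‖ * schatten p a := by
    obtain ⟨n, s, ξ, η, ha⟩ := exists_isSVD a
    rw [schatten_eq ha]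
    positivity
  refine (schatten_sandwich p _ _ a).trans ?_
  have h1 : ‖ContinuousLinearMap.id ℂ L‖ ≤ 1 := ContinuousLinearMap.norm_id_le
  have h2 := norm_nonneg (ContinuousLinearMap.id ℂ L)
  calc ‖c • ContinuousLinearMap.id ℂ L‖ * schatten p a * ‖ContinuousLinearMap.id ℂ L‖
      = (‖c‖ * schatten p a) * (‖ContinuousLinearMap.id ℂ L‖ * ‖ContinuousLinearMap.id ℂ L‖) := by
        rw [norm_smul]; ring
    _ ≤ (‖c‖ * schatten p a) * 1 :=
        mul_le_mul_of_nonneg_left (mul_le_one₀ h1 h2 h1) h0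
    _ = _ := mul_one _

theorem schatten_rk (ξ η : L) (hξ : ‖ξ‖ = 1) (hη : ‖η‖ = 1) : schatten p (rk ξ η) = 1 := by
  have h : IsSVD (rk ξ η) (fun _ : Fin 1 => 1) (fun _ => ξ) (fun _ => η) :=
    ⟨⟨fun _ => hξ, fun i j hij => (hij (Subsingleton.elim i j)).elim⟩,
      ⟨fun _ => hη, fun i j hij => (hij (Subsingleton.elim i j)).elim⟩, fun _ => zero_le_one,
      by simp⟩
  rw [schatten_eq h]
  by_cases hp : p = ∞
  · subst hp
    simp [PiLp.norm_eq_ciSup]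
  · have hp0 : 0 < p.toReal := ENNReal.toReal_pos
      (zero_lt_one.trans_le (Fact.out : 1 ≤ p)).ne' hp
    simp [PiLp.norm_eq_sum hp0]

variable (L) in
/-- The proto-quantum space `⁽ᵖ⁾ℂ`: the amplification `K ⊗ ℂ = K` carries the `p`-th Schatten
norm. -/
def schattenSpace : PQSpace L ℂ where
  toSeminorm := Seminorm.ofSMulLE (fun u => schatten p (TensorProduct.rid ℂ (K L) u))
    (by
      rw [map_zero]
      refine le_antisymm (by simpa using schatten_smul_le p 0 (0 : K L)) ?_
      obtain ⟨n, s, ξ, η, ha⟩ := exists_isSVD (0 : K L)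
      rw [schatten_eq ha]
      positivity)
    (fun u v => by
      rw [map_add]
      exact schatten_add p _ _)
    (fun c u => by
      rw [map_smul]
      exact schatten_smul_le p c _)
  contractive' a b u := by
    have h : TensorProduct.rid ℂ (K L) (bimod ℂ a b u) =
        sandwich a b (TensorProduct.rid ℂ (K L) u) := by
      induction u with
      | zero => simp
      | add u v hu hv => simp only [map_add, hu, hv]
      | tmul k c => simp [bimod]
    change schatten p (TensorProduct.rid ℂ (K L) (bimod ℂ a b u)) ≤
      ‖a‖ * schatten p (TensorProduct.rid ℂ (K L) u) * ‖b‖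
    rw [h]
    exact schatten_sandwich p a b _
  underlying' ξ η hξ hη x := by
    change schatten p (TensorProduct.rid ℂ (K L) (rk ξ η ⊗ₜ x)) = ‖x‖
    rw [TensorProduct.rid_tmul]
    have h0 := schatten_rk p ξ η hξ hη
    refine le_antisymm ((schatten_smul_le p x _).trans_eq (by rw [h0, mul_one])) ?_
    by_cases hx : x = 0
    · subst hx
      obtain ⟨n, s, ξ', η', ha⟩ := exists_isSVD ((0 : ℂ) • rk ξ η)
      rw [schatten_eq ha, norm_zero]
      positivity
    · have h1 := schatten_smul_le p x⁻¹ (x • rk ξ η)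
      rw [smul_smul, inv_mul_cancel₀ hx, one_smul, h0, norm_inv] at h1
      have h2 : 0 < ‖x‖ := norm_pos_iff.2 hx
      rwa [← div_eq_inv_mul, le_div_iff₀ h2, one_mul] at h1

end Schatten

section Underlying

variable {L : Type*} [NormedAddCommGroup L] [InnerProductSpace ℂ L]
variable {V : Type*} [AddCommGroup V] [Module ℂ V]

theorem PQSeminorm.nm_rk_eq [CompleteSpace L] (q : PQSeminorm L V) {ξ η ξ' η' : L}
    (hξ : ‖ξ‖ = 1) (hη : ‖η‖ = 1) (hξ' : ‖ξ'‖ = 1) (hη' : ‖η'‖ = 1) (x : V) :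
    q.nm (rk ξ η ⊗ₜ x) = q.nm (rk ξ' η' ⊗ₜ x) := by
  have key : ∀ {ξ η ξ' η' : L}, ‖ξ‖ = 1 → ‖η‖ = 1 → ‖ξ'‖ = 1 → ‖η'‖ = 1 →
      q.nm (rk ξ η ⊗ₜ x) ≤ q.nm (rk ξ' η' ⊗ₜ x) := by
    intro ξ η ξ' η' hξ hη hξ' hη'
    have h := q.nm_bimod (rankOne ℂ ξ ξ') (rankOne ℂ η' η) (rk ξ' η' ⊗ₜ x)
    rw [bimod, LinearMap.rTensor_tmul, sandwich_rk] at h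
    simpa [hξ, hη, hξ', hη', inner_self_eq_norm_sq_to_K] using h
  exact le_antisymm (key hξ hη hξ' hη') (key hξ' hη' hξ hη)

/-- The linear space `V` as the underlying (semi-)normed space of the proto-quantum semi-norm `q`:
`‖x‖ = ‖Q ⊗ x‖`, where `Q` is an arbitrary operator of rank one and norm one. -/
def Underlying (_q : PQSeminorm L V) : Type _ := V

namespace Underlying

variable (q : PQSeminorm L V)

instance : AddCommGroup (Underlying q) := inferInstanceAs (AddCommGroup V)

instance : Module ℂ (Underlying q) := inferInstanceAs (Module ℂ V)

/-- The identity map `V → Underlying q`. -/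
def of : V ≃ₗ[ℂ] Underlying q := LinearEquiv.refl ℂ V

variable [Nontrivial L]

theorem exists_unitVec (L : Type*) [NormedAddCommGroup L] [InnerProductSpace ℂ L] [Nontrivial L] :
    ∃ e : L, ‖e‖ = 1 := by
  obtain ⟨x, hx⟩ := exists_ne (0 : L)
  exact ⟨((‖x‖⁻¹ : ℝ) : ℂ) • x, by simp [norm_smul, norm_ne_zero_iff.2 hx]⟩

/-- A unit vector in `L`. -/
def unitVec (L : Type*) [NormedAddCommGroup L] [InnerProductSpace ℂ L] [Nontrivial L] : L :=
  (exists_unitVec L).choose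

theorem norm_unitVec : ‖unitVec L‖ = 1 := (exists_unitVec L).choose_spec

instance : SeminormedAddCommGroup (Underlying q) :=
  AddGroupSeminorm.toSeminormedAddCommGroup
    (E := Underlying q)
    { toFun := fun x => q.nm (rk (unitVec L) (unitVec L) ⊗ₜ[ℂ] (of q).symm x)
      map_zero' := by simp [q.nm_zero]
      add_le' := fun x y => by
        rw [map_add, TensorProduct.tmul_add]
        exact q.nm_add _ _
      neg' := fun x => by
        rw [map_neg, TensorProduct.tmul_neg]
        exact map_neg_eq_map q.toSeminorm _ }

theorem norm_of (x : V) : ‖of q x‖ = q.nm (rk (unitVec L) (unitVec L) ⊗ₜ[ℂ] x) := rfl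

instance : NormedSpace ℂ (Underlying q) where
  norm_smul_le c x := by
    change q.nm (_ ⊗ₜ[ℂ] (c • (of q).symm x)) ≤ ‖c‖ * q.nm (_ ⊗ₜ[ℂ] (of q).symm x)
    rw [TensorProduct.tmul_smul]
    exact (q.nm_smul c _).le

end Underlying

/-- A linear space with a proto-quantum semi-norm as a proto-quantum space over its underlying
space. -/
def PQSeminorm.toSpace [Nontrivial L] [CompleteSpace L] (q : PQSeminorm L V) :
    PQSpace L (Underlying q) where
  toFun := q.toFun
  map_zero' := q.map_zero'
  add_le' := q.add_le'
  neg' := q.neg'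
  smul' := q.smul'
  contractive' := q.contractive'
  underlying' _ _ hξ hη x :=
    q.nm_rk_eq hξ hη Underlying.norm_unitVec Underlying.norm_unitVec ((Underlying.of q).symm x)

end Underlying

section Pop

open UniformSpace (Completion)

variable {L : Type*} [NormedAddCommGroup L] [InnerProductSpace ℂ L]

variable (L) in
/-- The Hilbert tensor product of `L` with itself. -/
abbrev HilbertSquare : Type _ := Completion (L ⊗[ℂ] L)

variable (ι : HilbertSquare L ≃ₗᵢ[ℂ] L)

/-- `ξ ⋄ η = ι (ξ ⊗ η)`. -/
def diamondVec (ξ η : L) : L := ι ((ξ ⊗ₜ[ℂ] η : L ⊗[ℂ] L) : HilbertSquare L)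

/-- `a ⋄ b = ι (a ⊗ b) ι⁻¹`, where `a ⊗ b` is the Hilbert tensor product of bounded operators. -/
def diamond (a b : L →L[ℂ] L) : L →L[ℂ] L :=
  (ι : HilbertSquare L →L[ℂ] L) ∘L (TensorProduct.mapL a b).completion ∘L
    (ι.symm : L →L[ℂ] HilbertSquare L)

theorem diamond_apply (a b : L →L[ℂ] L) (ξ η : L) :
    diamond ι a b (diamondVec ι ξ η) = diamondVec ι (a ξ) (b η) := by
  simp [diamond, diamondVec]

theorem norm_diamondVec (ξ η : L) : ‖diamondVec ι ξ η‖ = ‖ξ‖ * ‖η‖ := by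
  simp [diamondVec]

theorem diamondVec_add_left (ξ ξ' η : L) :
    diamondVec ι (ξ + ξ') η = diamondVec ι ξ η + diamondVec ι ξ' η := by
  rw [diamondVec, TensorProduct.add_tmul, Completion.coe_add, map_add]
  rfl

theorem diamondVec_add_right (ξ η η' : L) :
    diamondVec ι ξ (η + η') = diamondVec ι ξ η + diamondVec ι ξ η' := by
  rw [diamondVec, TensorProduct.tmul_add, Completion.coe_add, map_add]
  rfl

theorem diamondVec_smul_left (c : ℂ) (ξ η : L) :
    diamondVec ι (c • ξ) η = c • diamondVec ι ξ η := by
  rw [diamondVec, ← TensorProduct.smul_tmul', Completion.coe_smul, map_smul]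
  rfl

theorem diamondVec_smul_right (c : ℂ) (ξ η : L) :
    diamondVec ι ξ (c • η) = c • diamondVec ι ξ η := by
  rw [diamondVec, TensorProduct.tmul_smul, Completion.coe_smul, map_smul]
  rfl

/-- Two bounded operators that agree on all `ξ ⋄ η` coincide. -/
theorem ext_diamondVec {G : Type*} [NormedAddCommGroup G] [NormedSpace ℂ G] {f g : L →L[ℂ] G}
    (h : ∀ ξ η, f (diamondVec ι ξ η) = g (diamondVec ι ξ η)) : f = g := by
  have h1 : ∀ z : HilbertSquare L, f (ι z) = g (ι z) := by
    intro z
    induction z using Completion.induction_on with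
    | hp => exact isClosed_eq (by fun_prop) (by fun_prop)
    | ih z =>
      induction z with
      | zero => rw [Completion.coe_zero, map_zero, map_zero, map_zero]
      | tmul ξ η => exact h ξ η
      | add x y hx hy => rw [Completion.coe_add, map_add, map_add, map_add, hx, hy]
  ext x
  simpa using h1 (ι.symm x)

theorem diamond_add_left (a a' b : L →L[ℂ] L) :
    diamond ι (a + a') b = diamond ι a b + diamond ι a' b :=
  ext_diamondVec ι fun ξ η => by
    simp only [add_apply, diamond_apply, diamondVec_add_left]

theorem diamond_add_right (a b b' : L →L[ℂ] L) :
    diamond ι a (b + b') = diamond ι a b + diamond ι a b' :=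
  ext_diamondVec ι fun ξ η => by
    simp only [add_apply, diamond_apply, diamondVec_add_right]

theorem diamond_smul_left (c : ℂ) (a b : L →L[ℂ] L) :
    diamond ι (c • a) b = c • diamond ι a b :=
  ext_diamondVec ι fun ξ η => by
    simp only [smul_apply, diamond_apply, diamondVec_smul_left]

theorem diamond_smul_right (c : ℂ) (a b : L →L[ℂ] L) :
    diamond ι a (c • b) = c • diamond ι a b :=
  ext_diamondVec ι fun ξ η => by
    simp only [smul_apply, diamond_apply, diamondVec_smul_right]

theorem inner_diamondVec (ξ η ξ' η' : L) :
    inner ℂ (diamondVec ι ξ η) (diamondVec ι ξ' η') = inner ℂ ξ ξ' * inner ℂ η η' := by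
  rw [diamondVec, diamondVec, LinearIsometryEquiv.inner_map_map, Completion.inner_coe,
    TensorProduct.inner_tmul]

theorem diamond_rankOne (ξ η ξ' η' : L) :
    diamond ι (rankOne ℂ ξ η) (rankOne ℂ ξ' η') =
      rankOne ℂ (diamondVec ι ξ ξ') (diamondVec ι η η') :=
  ext_diamondVec ι fun x y => by
    rw [diamond_apply, rankOne_apply, rankOne_apply, rankOne_apply, inner_diamondVec,
      diamondVec_smul_left, diamondVec_smul_right, smul_smul]

variable [CompleteSpace L]

theorem diamond_finite (a b : K L) :
    FiniteDimensional ℂ (LinearMap.range (diamond ι (op a) (op b) : L →ₗ[ℂ] L)) := by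
  change diamond ι (op a) (op b) ∈ finiteRank L
  obtain ⟨n, ξ, η, rfl⟩ := exists_sum_rk a
  obtain ⟨m, ξ', η', rfl⟩ := exists_sum_rk b
  have h1 : ∀ (n : ℕ) (f : Fin n → L →L[ℂ] L) (b : L →L[ℂ] L),
      diamond ι (∑ i, f i) b = ∑ i, diamond ι (f i) b := fun n f b =>
    map_sum (AddMonoidHom.mk' (fun a => diamond ι a b) (fun x y => diamond_add_left ι x y b)) f _
  have h2 : ∀ (n : ℕ) (f : Fin n → L →L[ℂ] L) (a : L →L[ℂ] L),
      diamond ι a (∑ i, f i) = ∑ i, diamond ι a (f i) := fun n f a =>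
    map_sum (AddMonoidHom.mk' (fun b => diamond ι a b) (fun x y => diamond_add_right ι a x y)) f _
  rw [map_sum, map_sum, h1]
  refine Submodule.sum_mem _ fun i _ => ?_
  rw [h2]
  refine Submodule.sum_mem _ fun j _ => ?_
  rw [op_rk, op_rk, diamond_rankOne]
  exact rankOne_finite _ _

/-- The operation `⋄` on operators of finite rank, as a bilinear operator. -/
def diamondK : K L →ₗ[ℂ] K L →ₗ[ℂ] K L :=
  LinearMap.mk₂ ℂ (fun a b => mkK (diamond ι (op a) (op b)) (diamond_finite ι a b))
    (fun a a' b => op_injective (by simp [diamond_add_left]))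
    (fun c a b => op_injective (by simp [diamond_smul_left]))
    (fun a b b' => op_injective (by simp [diamond_add_right]))
    (fun c a b => op_injective (by simp [diamond_smul_right]))

theorem op_diamondK (a b : K L) : op (diamondK ι a b) = diamond ι (op a) (op b) := rfl

theorem diamondK_rk (ξ η ξ' η' : L) :
    diamondK ι (rk ξ η) (rk ξ' η') = rk (diamondVec ι ξ ξ') (diamondVec ι η η') :=
  op_injective (diamond_rankOne ι ξ η ξ' η')

/-- `u ⋄ v ∈ K ⊗ (E ⊗ F)` for `u ∈ K ⊗ E`, `v ∈ K ⊗ F`; on elementary tensors it is given by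
`(a ⊗ x) ⋄ (b ⊗ y) = (a ⋄ b) ⊗ (x ⊗ y)`. -/
def diamondAmp (E F : Type*) [AddCommGroup E] [Module ℂ E] [AddCommGroup F] [Module ℂ F] :
    K L ⊗[ℂ] E →ₗ[ℂ] K L ⊗[ℂ] F →ₗ[ℂ] K L ⊗[ℂ] (E ⊗[ℂ] F) :=
  TensorProduct.map₂ (diamondK ι) (TensorProduct.mk ℂ E F)

theorem diamondAmp_tmul (E F : Type*) [AddCommGroup E] [Module ℂ E] [AddCommGroup F] [Module ℂ F]
    (a b : K L) (x : E) (y : F) :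
    diamondAmp ι E F (a ⊗ₜ x) (b ⊗ₜ y) = diamondK ι a b ⊗ₜ (x ⊗ₜ y) := rfl

variable {E F : Type*} [SeminormedAddCommGroup E] [NormedSpace ℂ E]
  [SeminormedAddCommGroup F] [NormedSpace ℂ F] (A : PQSpace L E) (B : PQSpace L F)

/-- `r` is the number `∑ ‖a_k‖ ‖u_k‖ ‖v_k‖ ‖b_k‖` for some representation
`U = ∑ a_k · (u_k ⋄ v_k) · b_k`. -/
def PopRep (U : K L ⊗[ℂ] (E ⊗[ℂ] F)) (r : ℝ) : Prop :=
  ∃ (n : ℕ) (a b : Fin n → L →L[ℂ] L) (u : Fin n → K L ⊗[ℂ] E) (v : Fin n → K L ⊗[ℂ] F),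
    U = ∑ k, bimod _ (a k) (b k) (diamondAmp ι E F (u k) (v k)) ∧
    r = ∑ k, ‖a k‖ * A.nm (u k) * B.nm (v k) * ‖b k‖

/-- `‖U‖_pop = inf ∑ ‖a_k‖ ‖u_k‖ ‖v_k‖ ‖b_k‖` over all representations
`U = ∑ a_k · (u_k ⋄ v_k) · b_k`. -/
def popNorm (U : K L ⊗[ℂ] (E ⊗[ℂ] F)) : ℝ := sInf {r | PopRep ι A B U r}

variable {ι A B}

theorem PopRep.nonneg {U : K L ⊗[ℂ] (E ⊗[ℂ] F)} {r : ℝ} (h : PopRep ι A B U r) : 0 ≤ r := by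
  obtain ⟨n, a, b, u, v, -, rfl⟩ := h
  exact Finset.sum_nonneg fun k _ => mul_nonneg (mul_nonneg (mul_nonneg (norm_nonneg _)
    (A.nm_nonneg _)) (B.nm_nonneg _)) (norm_nonneg _)

theorem PopRep.add {U V : K L ⊗[ℂ] (E ⊗[ℂ] F)} {r s : ℝ} (h : PopRep ι A B U r)
    (h' : PopRep ι A B V s) : PopRep ι A B (U + V) (r + s) := by
  obtain ⟨n, a, b, u, v, rfl, rfl⟩ := h
  obtain ⟨m, a', b', u', v', rfl, rfl⟩ := h'
  exact ⟨n + m, Fin.append a a', Fin.append b b', Fin.append u u', Fin.append v v',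
    by simp [Fin.sum_univ_add], by simp [Fin.sum_univ_add]⟩

theorem PopRep.bimod {U : K L ⊗[ℂ] (E ⊗[ℂ] F)} {r : ℝ} (h : PopRep ι A B U r)
    (c d : L →L[ℂ] L) : ∃ s ≤ ‖c‖ * r * ‖d‖, PopRep ι A B (bimod _ c d U) s := by
  obtain ⟨n, a, b, u, v, rfl, rfl⟩ := h
  refine ⟨_, ?_, n, fun k => c ∘L a k, fun k => b k ∘L d, u, v, ?_, rfl⟩
  · rw [Finset.mul_sum, Finset.sum_mul]
    refine Finset.sum_le_sum fun k _ => ?_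
    have h1 := A.nm_nonneg (u k)
    have h2 := B.nm_nonneg (v k)
    have h3 : ‖c ∘L a k‖ ≤ ‖c‖ * ‖a k‖ := ContinuousLinearMap.opNorm_comp_le _ _
    have h4 : ‖b k ∘L d‖ ≤ ‖b k‖ * ‖d‖ := ContinuousLinearMap.opNorm_comp_le _ _
    calc ‖c ∘L a k‖ * A.nm (u k) * B.nm (v k) * ‖b k ∘L d‖
        ≤ (‖c‖ * ‖a k‖) * A.nm (u k) * B.nm (v k) * (‖b k‖ * ‖d‖) := by
          refine mul_le_mul ?_ h4 (norm_nonneg _) ?_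
          · exact mul_le_mul_of_nonneg_right (mul_le_mul_of_nonneg_right h3 h1) h2
          · exact mul_nonneg (mul_nonneg (by positivity) h1) h2
      _ = _ := by ring
  · simp [map_sum, bimod_bimod]

variable (ι A B) in
theorem PopRep.exists [Nontrivial L] (U : K L ⊗[ℂ] (E ⊗[ℂ] F)) : ∃ r, PopRep ι A B U r := by
  induction U with
  | zero => exact ⟨0, 0, Fin.elim0, Fin.elim0, Fin.elim0, Fin.elim0, by simp, by simp⟩
  | add U V hU hV =>
    obtain ⟨r, hr⟩ := hU
    obtain ⟨s, hs⟩ := hV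
    exact ⟨_, hr.add hs⟩
  | tmul k w =>
    induction w with
    | zero => exact ⟨0, 0, Fin.elim0, Fin.elim0, Fin.elim0, Fin.elim0, by simp, by simp⟩
    | add w z hw hz =>
      obtain ⟨r, hr⟩ := hw
      obtain ⟨s, hs⟩ := hz
      rw [TensorProduct.tmul_add]
      exact ⟨_, hr.add hs⟩
    | tmul x y =>
      obtain ⟨n, ξ, η, rfl⟩ := exists_sum_rk k
      have he := Underlying.norm_unitVec (L := L)
      set e := Underlying.unitVec L
      set g := diamondVec ι e e
      have hg : inner ℂ g g = (1 : ℂ) := by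
        rw [inner_self_eq_norm_sq_to_K, norm_diamondVec, he]; simp
      refine ⟨_, n, fun i => rankOne ℂ (ξ i) g, fun i => rankOne ℂ g (η i),
        fun _ => rk e e ⊗ₜ x, fun _ => rk e e ⊗ₜ y, ?_, rfl⟩
      rw [TensorProduct.sum_tmul]
      refine Finset.sum_congr rfl fun i _ => ?_
      rw [diamondAmp_tmul, diamondK_rk, Proto.bimod, LinearMap.rTensor_tmul, sandwich_rk]
      simp only [adjoint_rankOne, rankOne_apply]
      change _ = rk (inner ℂ g g • ξ i) (inner ℂ g g • η i) ⊗ₜ _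
      rw [hg, one_smul, one_smul]

theorem popNorm_le {U : K L ⊗[ℂ] (E ⊗[ℂ] F)} {r : ℝ} (h : PopRep ι A B U r) :
    popNorm ι A B U ≤ r := csInf_le ⟨0, fun _ hs => hs.nonneg⟩ h

theorem le_popNorm [Nontrivial L] {U : K L ⊗[ℂ] (E ⊗[ℂ] F)} {c : ℝ}
    (h : ∀ r, PopRep ι A B U r → c ≤ r) : c ≤ popNorm ι A B U :=
  le_csInf (PopRep.exists ι A B U) h

theorem popNorm_nonneg (U : K L ⊗[ℂ] (E ⊗[ℂ] F)) : 0 ≤ popNorm ι A B U :=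
  Real.sInf_nonneg fun _ h => h.nonneg

theorem popNorm_bimod [Nontrivial L] (c d : L →L[ℂ] L) (U : K L ⊗[ℂ] (E ⊗[ℂ] F)) :
    popNorm ι A B (bimod _ c d U) ≤ ‖c‖ * popNorm ι A B U * ‖d‖ := by
  have h1 : ∀ r, PopRep ι A B U r → popNorm ι A B (bimod _ c d U) ≤ ‖c‖ * r * ‖d‖ := by
    intro r hr
    obtain ⟨s, hs, h⟩ := hr.bimod c d
    exact (popNorm_le h).trans hs
  rcases (mul_nonneg (norm_nonneg c) (norm_nonneg d)).eq_or_lt with h0 | h0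
  · obtain ⟨r, hr⟩ := PopRep.exists ι A B U
    have e1 : ‖c‖ * r * ‖d‖ = 0 := by rw [mul_right_comm, ← h0, zero_mul]
    have e2 : ‖c‖ * popNorm ι A B U * ‖d‖ = 0 := by rw [mul_right_comm, ← h0, zero_mul]
    rw [e2, ← e1]
    exact h1 r hr
  · rw [mul_right_comm, ← div_le_iff₀' h0]
    refine le_popNorm fun r hr => ?_
    rw [div_le_iff₀' h0, ← mul_right_comm]
    exact h1 r hr

variable (ι A B)

/-- The proto-operator-projective proto-quantum semi-norm on `E ⊗ F`. -/
def popSeminorm [Nontrivial L] : PQSeminorm L (E ⊗[ℂ] F) where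
  toSeminorm := Seminorm.ofSMulLE (popNorm ι A B)
    (le_antisymm (popNorm_le ⟨0, Fin.elim0, Fin.elim0, Fin.elim0, Fin.elim0, by simp, by simp⟩)
      (popNorm_nonneg _))
    (fun U V => by
      rw [← sub_le_iff_le_add]
      refine le_popNorm fun r hr => ?_
      rw [sub_le_comm]
      refine le_popNorm fun s hs => ?_
      rw [sub_le_iff_le_add']
      exact popNorm_le (hr.add hs))
    (fun c U => by
      have h : c • U = bimod _ (c • ContinuousLinearMap.id ℂ L) (ContinuousLinearMap.id ℂ L) U := by
        induction U with
        | zero => simp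
        | add x y hx hy => rw [smul_add, hx, hy, map_add]
        | tmul k w =>
          rw [bimod, LinearMap.rTensor_tmul, TensorProduct.smul_tmul']
          rfl
      rw [h]
      refine (popNorm_bimod _ _ U).trans_eq ?_
      rw [norm_smul, ContinuousLinearMap.norm_id]
      ring)
  contractive' := popNorm_bimod

/-- The non-completed proto-operator-projective tensor product, as a (semi-)normed space. -/
abbrev PopTensor [Nontrivial L] : Type _ := Underlying (popSeminorm ι A B)

/-- The completed proto-operator-projective tensor product, as a Banach space. -/
abbrev CompletedPopTensor [Nontrivial L] : Type _ := Completion (PopTensor ι A B)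

/-- The completed proto-operator-projective tensor product of proto-quantum spaces: the completion
of `E ⊗ F` with the proto-quantum norm `‖·‖_pop`. -/
def completedPop [Nontrivial L] : PQSpace L (CompletedPopTensor ι A B) :=
  (popSeminorm ι A B).toSpace.completion

/-- The elementary tensor `x ⊗ y` in the completed proto-operator-projective tensor product. -/
def popTmul [Nontrivial L] (x : E) (y : F) : CompletedPopTensor ι A B :=
  ((Underlying.of (popSeminorm ι A B) (x ⊗ₜ y) : PopTensor ι A B) : CompletedPopTensor ι A B)

end Pop

end Proto

end

/-! On `K ⊗ (L₁(X) ⊗ F)` the norm `‖·‖_pop` coincides with the norm pulled back from `L₁(X, K ⊗ F)`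
along `k ⊗ (z ⊗ y) ↦ z(·) (k ⊗ y)` (`PQSpace.IsConvex.popNorm_eq`). The theorem follows from this
equality by passing to completions.

The pulled-back norm is at most `‖·‖_pop`: this is where `p`-convexity enters, through the
inequality `‖a ⋄ v‖ ≤ ‖a‖_p ‖v‖` for `a ∈ K`, `v ∈ K ⊗ F` (`PQSpace.IsConvex.nm_diamondLeft_le`).
Write `S_ξ` for the operator `η ↦ ξ ⋄ η`. A singular value decomposition `a = ∑ s_k ξ_k ∘ η_k` gives
`a ⋄ v = ∑ s_k S_{ξ_k} · v · S_{η_k}*`. A partial isometry `W` on the left replaces `ξ_k` by `η_k`,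
and the remaining summands `s_k S_{η_k} · v · S_{η_k}*` have pairwise orthogonal supports and norms
at most `s_k ‖v‖`. The inequality is then applied at each point `t` and integrated, and the result
is summed over a representation of `U`.

The converse estimate is the universal property of Bochner `L₁` spaces. The map `(z, a ⊗ y) ↦ a ⊗ (z
⊗ y)` is a bilinear contraction from `L₁(X) × (K ⊗ F)` into the completion of `K ⊗ (L₁(X) ⊗ F)` with
`‖·‖_pop` (`popNorm_lTensor_mk_le`). It therefore extends to a linear contraction on `L₁(X, K ⊗ F)`,
which sends the image of `U` back to `U` (`setToL1_alpha_scalarTensor`).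

With both estimates, `z ⊗ y ↦ z(·) y` is isometric and extends to the completion. The range is
closed and contains the functions `χ_s y`, hence is everything. Amplified norms survive the
completion by approximation (`PQSpace.nm_lTensor_eq_of_completion`). -/

noncomputable section

namespace Proto

/-! ### Tensoring with a finite rank operator, and its Schatten norm bound under `p`-convexity -/

section DiamondSchatten

variable {L : Type*} [NormedAddCommGroup L] [InnerProductSpace ℂ L]
variable (ι : HilbertSquare L ≃ₗᵢ[ℂ] L)

/-- The bounded operator `η ↦ ξ ⋄ η`. -/
def diamondL (ξ : L) : L →L[ℂ] L :=
  LinearMap.mkContinuous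
    { toFun := diamondVec ι ξ
      map_add' := diamondVec_add_right ι ξ
      map_smul' := fun c η => diamondVec_smul_right ι c ξ η }
    ‖ξ‖ fun η => (norm_diamondVec ι ξ η).le

theorem diamondL_apply (ξ η : L) : diamondL ι ξ η = diamondVec ι ξ η := rfl

theorem norm_diamondL_le (ξ : L) : ‖diamondL ι ξ‖ ≤ ‖ξ‖ :=
  LinearMap.mkContinuous_norm_le _ (norm_nonneg _) _

variable [CompleteSpace L]

theorem adjoint_diamondL_diamondVec (ζ ξ η : L) :
    (diamondL ι ζ).adjoint (diamondVec ι ξ η) = inner ℂ ζ ξ • η := by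
  refine ext_inner_left ℂ fun v => ?_
  rw [ContinuousLinearMap.adjoint_inner_right, diamondL_apply, inner_diamondVec, inner_smul_right]

/-- For orthonormal `ξ_k` the operators `diamondL ι (ξ_k)` are thus isometries with pairwise
orthogonal ranges. This is the source of the orthogonal supports needed for `p`-convexity. -/
theorem adjoint_diamondL_comp (ζ ξ : L) :
    (diamondL ι ζ).adjoint ∘L diamondL ι ξ = (inner ℂ ζ ξ : ℂ) • ContinuousLinearMap.id ℂ L := by
  ext η
  simp [diamondL_apply, adjoint_diamondL_diamondVec]

/-- Tensoring with a rank one operator becomes a two-sided multiplication, so that it can be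
estimated by contractivity of the bimodule. -/
theorem diamond_rankOne_left (ξ η : L) (a : L →L[ℂ] L) :
    diamond ι (rankOne ℂ ξ η) a = diamondL ι ξ ∘L a ∘L (diamondL ι η).adjoint :=
  ext_diamondVec ι fun x y => by
    simp [diamond_apply, adjoint_diamondL_diamondVec, diamondL_apply, diamondVec_smul_left]

theorem diamondK_rk_left (ξ η : L) (a : K L) :
    diamondK ι (rk ξ η) a = sandwich (diamondL ι ξ) (diamondL ι η).adjoint a :=
  op_injective (diamond_rankOne_left ι ξ η (op a))

/-- The operation `(a, b ⊗ x) ↦ (a ⋄ b) ⊗ x`. -/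
def diamondLeft (E : Type*) [AddCommGroup E] [Module ℂ E] :
    K L →ₗ[ℂ] K L ⊗[ℂ] E →ₗ[ℂ] K L ⊗[ℂ] E :=
  LinearMap.rTensorHom E ∘ₗ diamondK ι

theorem diamondLeft_tmul {E : Type*} [AddCommGroup E] [Module ℂ E] (a b : K L) (x : E) :
    diamondLeft ι E a (b ⊗ₜ x) = diamondK ι a b ⊗ₜ x := rfl

theorem diamondLeft_rk {E : Type*} [AddCommGroup E] [Module ℂ E] (ξ η : L) (v : K L ⊗[ℂ] E) :
    diamondLeft ι E (rk ξ η) v = bimod E (diamondL ι ξ) (diamondL ι η).adjoint v := by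
  have h : diamondK ι (rk ξ η) = sandwich (diamondL ι ξ) (diamondL ι η).adjoint :=
    LinearMap.ext (diamondK_rk_left ι ξ η)
  change (diamondK ι (rk ξ η)).rTensor E v = _
  rw [h, bimod]

/-- Monotonicity of the `ℓ_p` norm, uniformly in `p` including `∞`: it is the Schur bound for the
diagonal matrix with entries `M`. -/
theorem norm_toLp_le_mul {p : ℝ≥0∞} [Fact (1 ≤ p)] {n : ℕ} {c s : Fin n → ℝ} {M : ℝ}
    (hM : 0 ≤ M) (hs : ∀ k, 0 ≤ s k) (hc : ∀ k, ‖c k‖ ≤ M * s k) :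
    ‖WithLp.toLp p c‖ ≤ M * ‖WithLp.toLp p s‖ := by
  rw [← norm_toLp_ofReal]
  refine schur_bound (fun k j => if k = j then M else 0) (fun k j => ?_) hM (by simp) (by simp)
    s hs _ (by simpa using hc)
  split_ifs <;> simp [hM]

/-- The operators `S_k = (η_k ⋄ ·)` for orthonormal `η_k` have pairwise orthogonal ranges, and
`∑ T_k S_k*` is a contraction if also the `T_k` are of this form. -/
theorem norm_sum_diamondL_comp_adjoint_le {n : ℕ} {ξ η : Fin n → L} (hξ : Orthonormal ℂ ξ)
    (hη : Orthonormal ℂ η) :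
    ‖∑ k, diamondL ι (ξ k) ∘L (diamondL ι (η k)).adjoint‖ ≤ 1 := by
  set W := ∑ k, diamondL ι (ξ k) ∘L (diamondL ι (η k)).adjoint with hW
  have hx : ∀ (ζ : Fin n → L), Orthonormal ℂ ζ → ∀ (i j : Fin n) (x : L),
      (diamondL ι (ζ i)).adjoint (diamondL ι (ζ j) x) = if i = j then x else 0 := by
    intro ζ hζ i j x
    have h := congrArg (fun T : L →L[ℂ] L => T x) (adjoint_diamondL_comp ι (ζ i) (ζ j))
    rw [orthonormal_iff_ite.1 hζ] at h
    simp only [ContinuousLinearMap.comp_apply] at h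
    rw [h]
    split_ifs <;> simp
  -- `W* W` is the sum of the pairwise orthogonal projections `S_k S_k*`, where `S_k` belongs to
  -- `η_k`; hence it is a projection, and `‖W‖² = ‖W* W‖ ≤ 1`.
  have hWW : W.adjoint ∘L W = ∑ k, diamondL ι (η k) ∘L (diamondL ι (η k)).adjoint := by
    ext x
    simp only [hW, map_sum, ContinuousLinearMap.adjoint_comp, ContinuousLinearMap.adjoint_adjoint,
      ContinuousLinearMap.comp_apply, sum_apply, hx ξ hξ]
    refine Finset.sum_congr rfl fun k _ => ?_
    rw [Finset.sum_eq_single k _ (by simp), if_pos rfl]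
    intro j _ hj
    rw [if_neg hj, map_zero]
  have hP : IsStarProjection (W.adjoint ∘L W) := by
    constructor
    · change (W.adjoint ∘L W) ∘L (W.adjoint ∘L W) = W.adjoint ∘L W
      rw [hWW]
      ext x
      simp only [map_sum, ContinuousLinearMap.comp_apply, sum_apply, hx η hη]
      refine Finset.sum_congr rfl fun k _ => ?_
      rw [Finset.sum_eq_single k _ (by simp), if_pos rfl]
      intro j _ hj
      rw [if_neg hj, map_zero]
    · change star (W.adjoint ∘L W) = _
      rw [ContinuousLinearMap.star_eq_adjoint, ContinuousLinearMap.adjoint_comp,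
        ContinuousLinearMap.adjoint_adjoint]
  have h1 := hP.norm_le
  rw [ContinuousLinearMap.norm_adjoint_comp_self] at h1
  nlinarith [norm_nonneg W]

variable {F : Type*} [SeminormedAddCommGroup F] [NormedSpace ℂ F] {B : PQSpace L F}

/-- The only place where the convexity inequality itself is applied. The supports in its definition
are two-sided, whereas `s_k S_{ξ_k} · v · S_{η_k}*` has different left and right supports. Factoring
out the contraction `W` on the left repairs this. -/
theorem PQSpace.IsConvex.nm_diamondLeft_le {p : ℝ≥0∞} [Fact (1 ≤ p)] (hB : B.IsConvex p)
    (a : K L) (v : K L ⊗[ℂ] F) : B.nm (diamondLeft ι F a v) ≤ schatten p a * B.nm v := by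
  obtain ⟨n, s, ξ, η, h⟩ := exists_isSVD a
  set S := fun k => diamondL ι (η k) with hS
  set W := ∑ k, diamondL ι (ξ k) ∘L (S k).adjoint with hW
  have hSS : ∀ i j, (S i).adjoint ∘L S j =
      (if i = j then (1 : ℂ) else 0) • ContinuousLinearMap.id ℂ L := fun i j => by
    rw [hS, adjoint_diamondL_comp, orthonormal_iff_ite.1 h.right]
  have hSk : ∀ k, (S k).adjoint ∘L S k = ContinuousLinearMap.id ℂ L := fun k => by
    rw [hSS, if_pos rfl, one_smul]
  have hWS : ∀ k, W ∘L S k = diamondL ι (ξ k) := by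
    intro k
    rw [hW]
    simp only [ContinuousLinearMap.finsetSum_comp, ContinuousLinearMap.comp_assoc, hSS]
    ext x
    simp [ite_smul, apply_ite]
  have hW1 : ‖W‖ ≤ 1 := norm_sum_diamondL_comp_adjoint_le ι h.left h.right
  set u := fun k => (s k : ℂ) • bimod F (S k) (S k).adjoint v with hu
  -- Since `W S_k = S_{ξ_k}`, left multiplication by `W` turns `u_k` into the `k`-th term of the
  -- expansion of `a ⋄ v`.
  have hau : diamondLeft ι F a v = bimod F W (ContinuousLinearMap.id ℂ L) (∑ k, u k) := by
    rw [h.eq, map_sum, LinearMap.sum_apply, map_sum]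
    refine Finset.sum_congr rfl fun k _ => ?_
    rw [map_smul, LinearMap.smul_apply, diamondLeft_rk, hu, map_smul, bimod_bimod, hWS]
    rfl
  -- The projections onto the ranges of the isometries `S_k` serve as supports. The three remaining
  -- goals are that they are projections, that they are pairwise orthogonal, and that they support
  -- the `u_k`; all come from `S_i* S_j = δ_ij`.
  have hsum := hB n u (fun k => S k ∘L (S k).adjoint) ?_ ?_ ?_
  · have h0 : B.nm (diamondLeft ι F a v) ≤ B.nm (∑ k, u k) := by
      rw [hau]
      refine (B.nm_bimod W (ContinuousLinearMap.id ℂ L) _).trans ?_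
      have h1 : ‖ContinuousLinearMap.id ℂ L‖ ≤ 1 := ContinuousLinearMap.norm_id_le
      have h2 := B.nm_nonneg (∑ k, u k)
      calc _ ≤ 1 * B.nm (∑ k, u k) * 1 := by
            refine mul_le_mul (mul_le_mul_of_nonneg_right hW1 h2) h1 (norm_nonneg _) ?_
            rw [one_mul]; exact h2
        _ = _ := by ring
    refine h0.trans (hsum.trans ?_)
    rw [schatten_eq h, mul_comm]
    refine norm_toLp_le_mul (B.nm_nonneg v) h.nonneg fun k => ?_
    rw [Real.norm_of_nonneg (show 0 ≤ B.nm (u k) from B.nm_nonneg _)]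
    have h1 : B.nm (u k) = ‖(s k : ℂ)‖ * B.nm (bimod F (S k) (S k).adjoint v) := B.nm_smul _ _
    have h2 : B.nm (bimod F (S k) (S k).adjoint v) ≤ ‖S k‖ * B.nm v * ‖(S k).adjoint‖ :=
      B.nm_bimod _ _ _
    have h3 : ‖S k‖ ≤ 1 := (norm_diamondL_le ι (η k)).trans_eq (h.right.1 k)
    have h4 : B.nm (bimod F (S k) (S k).adjoint v) ≤ B.nm v := by
      refine h2.trans ?_
      rw [LinearIsometryEquiv.norm_map, mul_right_comm]
      exact mul_le_of_le_one_left (B.nm_nonneg v) (mul_le_one₀ h3 (norm_nonneg _) h3)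
    rw [h1, Complex.norm_real, Real.norm_of_nonneg (h.nonneg k), mul_comm]
    exact mul_le_mul_of_nonneg_right h4 (h.nonneg k)
  · intro k
    constructor
    · change (S k ∘L (S k).adjoint) ∘L (S k ∘L (S k).adjoint) = _
      rw [ContinuousLinearMap.comp_assoc, ← ContinuousLinearMap.comp_assoc (S k).adjoint, hSk,
        ContinuousLinearMap.id_comp]
    · change star (S k ∘L (S k).adjoint) = _
      rw [ContinuousLinearMap.star_eq_adjoint, ContinuousLinearMap.adjoint_comp,
        ContinuousLinearMap.adjoint_adjoint]
  · intro j k hjk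
    rw [ContinuousLinearMap.comp_assoc, ← ContinuousLinearMap.comp_assoc (S j).adjoint, hSS,
      if_neg hjk, zero_smul, ContinuousLinearMap.zero_comp, ContinuousLinearMap.comp_zero]
  · intro k
    rw [hu]
    simp only [map_smul, bimod_bimod]
    rw [ContinuousLinearMap.comp_assoc, hSk, ContinuousLinearMap.comp_id,
      ← ContinuousLinearMap.comp_assoc, hSk, ContinuousLinearMap.id_comp]

end DiamondSchatten

open UniformSpace (Completion)

/-! ### The operator `z ⊗ y ↦ z(·) y` and the bound of its amplification by `‖·‖_pop` -/

section ScalarTensor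

variable {X : Type*} [MeasurableSpace X] (μ : Measure X)
variable (F : Type*) [NormedAddCommGroup F] [NormedSpace ℂ F]

/-- The operator `L₁(X) ⊗ F → L₁(X, F)`, which takes `z ⊗ y` to the function `t ↦ z(t) y`. -/
def scalarTensor : Lp ℂ 1 μ ⊗[ℂ] F →ₗ[ℂ] Lp F 1 μ :=
  TensorProduct.lift <| LinearMap.flip
    { toFun := fun y => ((ContinuousLinearMap.toSpanSingleton ℂ y).compLpL 1 μ).toLinearMap
      map_add' := fun y y' => by
        rw [ContinuousLinearMap.toSpanSingleton_add, ContinuousLinearMap.add_compLpL]; rfl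
      map_smul' := fun c y => by
        rw [ContinuousLinearMap.toSpanSingleton_smul, ContinuousLinearMap.smul_compLpL]; rfl }

variable {F}

theorem scalarTensor_tmul (z : Lp ℂ 1 μ) (y : F) :
    scalarTensor μ F (z ⊗ₜ y) = (ContinuousLinearMap.toSpanSingleton ℂ y).compLpL 1 μ z := rfl

theorem coeFn_scalarTensor_tmul (z : Lp ℂ 1 μ) (y : F) :
    scalarTensor μ F (z ⊗ₜ y) =ᵐ[μ] fun t => z t • y := by
  rw [scalarTensor_tmul]
  filter_upwards [(ContinuousLinearMap.toSpanSingleton ℂ y).coeFn_compLpL (p := 1) (μ := μ) z]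
    with t ht
  rw [ht, ContinuousLinearMap.toSpanSingleton_apply]

variable {L : Type*} [NormedAddCommGroup L] [InnerProductSpace ℂ L] [CompleteSpace L]
variable (B : PQSpace L F)

/-- An elementary tensor becomes the function `z(·) w` with the constant vector `w = k ⊗ y`.
Computations on elementary tensors in both estimates start from this form. -/
theorem alpha_scalarTensor_tmul (k : K L) (z : Lp ℂ 1 μ) (y : F) :
    alpha μ B (k ⊗ₜ scalarTensor μ F (z ⊗ₜ y)) =
      (ContinuousLinearMap.toSpanSingleton ℂ (Amp.of B (k ⊗ₜ y))).compLpL 1 μ z := by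
  rw [alpha_tmul]
  apply Lp.ext
  filter_upwards [coeFn_scalarTensor_tmul μ z y,
    (Amp.tmulL B k).coeFn_compLpL (p := 1) (μ := μ) (scalarTensor μ F (z ⊗ₜ y)),
    (ContinuousLinearMap.toSpanSingleton ℂ (Amp.of B (k ⊗ₜ y))).coeFn_compLpL (p := 1) (μ := μ) z]
    with t h1 h2 h3
  rw [h2, h1, h3, map_smul, Amp.tmulL_apply, ContinuousLinearMap.toSpanSingleton_apply]

variable (ι : HilbertSquare L ≃ₗᵢ[ℂ] L) (A : PQSpace L ℂ)

/-- Both sides are bilinear in `u` and `v`, and for `u = a ⊗ z`, `v = b ⊗ y` both are `z(t) (a ⋄ b)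
⊗ y`. At almost every `t` the operation `u ⋄ v` is thus `u(t) ⋄ v` with `u(t) ∈ K ⊗ ℂ = K`, the
setting of `PQSpace.IsConvex.nm_diamondLeft_le`. -/
theorem coeFn_alpha_scalarTensor_diamondAmp (u : K L ⊗[ℂ] Lp ℂ 1 μ) (v : K L ⊗[ℂ] F) :
    alpha μ B ((scalarTensor μ F).lTensor (K L) (diamondAmp ι _ F u v)) =ᵐ[μ] fun t =>
      Amp.of B (diamondLeft ι F
        (TensorProduct.rid ℂ (K L) ((Amp.of A).symm (alpha μ A u t))) v) := by
  induction u with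
  | zero =>
    simp only [map_zero, LinearMap.zero_apply]
    filter_upwards [Lp.coeFn_zero (Amp A) 1 μ, Lp.coeFn_zero (Amp B) 1 μ] with t h1 h2
    rw [h1, h2]
    simp
  | add u u' hu hu' =>
    simp only [map_add, LinearMap.add_apply]
    filter_upwards [hu, hu', Lp.coeFn_add (alpha μ A u) (alpha μ A u'),
      Lp.coeFn_add (alpha μ B ((scalarTensor μ F).lTensor (K L) (diamondAmp ι _ F u v)))
        (alpha μ B ((scalarTensor μ F).lTensor (K L) (diamondAmp ι _ F u' v)))] with t h1 h2 h3 h4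
    rw [h3, h4, Pi.add_apply, Pi.add_apply, h1, h2]
    simp only [map_add, LinearMap.add_apply]
  | tmul a z =>
    induction v with
    | zero =>
      simp only [map_zero]
      filter_upwards [Lp.coeFn_zero (Amp B) 1 μ] with t h2
      rw [h2]
      simp
    | add v v' hv hv' =>
      simp only [map_add]
      filter_upwards [hv, hv',
        Lp.coeFn_add
          (alpha μ B ((scalarTensor μ F).lTensor (K L) (diamondAmp ι _ F (a ⊗ₜ z) v)))
          (alpha μ B ((scalarTensor μ F).lTensor (K L) (diamondAmp ι _ F (a ⊗ₜ z) v')))]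
        with t h1 h2 h4
      rw [h4, Pi.add_apply, h1, h2]
    | tmul b y =>
      rw [diamondAmp_tmul, LinearMap.lTensor_tmul, alpha_scalarTensor_tmul, alpha_tmul]
      filter_upwards [(Amp.tmulL A a).coeFn_compLpL (p := 1) (μ := μ) z,
        (ContinuousLinearMap.toSpanSingleton ℂ
          (Amp.of B (diamondK ι a b ⊗ₜ y))).coeFn_compLpL (p := 1) (μ := μ) z] with t h1 h2
      rw [h1, h2, ContinuousLinearMap.toSpanSingleton_apply, Amp.tmulL_apply,
        LinearEquiv.symm_apply_apply, TensorProduct.rid_tmul, map_smul, LinearMap.smul_apply,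
        map_smul, diamondLeft_tmul]

variable {B}

theorem PQSpace.IsConvex.nm_scalarTensor_diamondAmp_le {p : ℝ≥0∞} [Fact (1 ≤ p)]
    (hB : B.IsConvex p) (u : K L ⊗[ℂ] Lp ℂ 1 μ) (v : K L ⊗[ℂ] F) :
    (B.L1 μ).nm ((scalarTensor μ F).lTensor (K L) (diamondAmp ι _ F u v)) ≤
      ((schattenSpace L p).L1 μ).nm u * B.nm v := by
  rw [mul_comm]
  -- The factor `B.nm v` does not depend on `t`, so the pointwise Schatten bound integrates to the
  -- product of the two norms.
  refine Lp.norm_le_mul_norm_of_ae_le_mul (c := B.nm v) (g := alpha μ (schattenSpace L p) u) ?_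
  filter_upwards [coeFn_alpha_scalarTensor_diamondAmp μ B ι (schattenSpace L p) u v] with t ht
  rw [ht, Amp.norm_of, mul_comm]
  exact hB.nm_diamondLeft_le ι _ v

/-- Any representation of `U` can be estimated term by term, because the amplification of
`scalarTensor` is a bimodule map and the bimodule over `L₁(X, F)` is contractive. -/
theorem PQSpace.IsConvex.nm_scalarTensor_le_popNorm [Nontrivial L] {p : ℝ≥0∞} [Fact (1 ≤ p)]
    (hB : B.IsConvex p) (U : K L ⊗[ℂ] (Lp ℂ 1 μ ⊗[ℂ] F)) :
    (B.L1 μ).nm ((scalarTensor μ F).lTensor (K L) U) ≤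
      popNorm ι ((schattenSpace L p).L1 μ) B U := by
  refine le_popNorm ?_
  rintro r ⟨n, a, b, u, v, rfl, rfl⟩
  rw [map_sum]
  refine (Finset.le_sum_of_subadditive (B.L1 μ).nm (B.L1 μ).nm_zero.le (B.L1 μ).nm_add _ _).trans
    (Finset.sum_le_sum fun k _ => ?_)
  have h : ∀ W : K L ⊗[ℂ] (Lp ℂ 1 μ ⊗[ℂ] F),
      (scalarTensor μ F).lTensor (K L) (bimod _ (a k) (b k) W) =
        bimod _ (a k) (b k) ((scalarTensor μ F).lTensor (K L) W) := by
    intro W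
    induction W with
    | zero => simp
    | add x y hx hy => simp [hx, hy]
    | tmul k w => simp [bimod]
  rw [h]
  refine ((B.L1 μ).nm_bimod _ _ _).trans ?_
  rw [mul_assoc ‖a k‖ (((schattenSpace L p).L1 μ).nm (u k))]
  exact mul_le_mul_of_nonneg_right (mul_le_mul_of_nonneg_left
    (hB.nm_scalarTensor_diamondAmp_le μ ι _ _) (norm_nonneg _)) (norm_nonneg _)

end ScalarTensor

/-! ### The bilinear contraction `(x, a ⊗ y) ↦ a ⊗ (x ⊗ y)` -/

section Insert

variable {L : Type*} [NormedAddCommGroup L] [InnerProductSpace ℂ L] [CompleteSpace L]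
  [Nontrivial L]
variable (ι : HilbertSquare L ≃ₗᵢ[ℂ] L)
variable {E F : Type*} [SeminormedAddCommGroup E] [NormedSpace ℂ E]
  [SeminormedAddCommGroup F] [NormedSpace ℂ F] (A : PQSpace L E) (B : PQSpace L F)

/-- `‖a ⊗ (x ⊗ y)‖_pop ≤ ‖x‖ ‖a ⊗ y‖`, more generally for sums of `a_i ⊗ y_i`. -/
theorem popNorm_lTensor_mk_le (x : E) (w : K L ⊗[ℂ] F) :
    popNorm ι A B ((TensorProduct.mk ℂ E F x).lTensor (K L) w) ≤ ‖x‖ * B.nm w := by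
  obtain ⟨e, he⟩ := Underlying.exists_unitVec L
  set S := diamondL ι e
  have hS : S.adjoint ∘L S = ContinuousLinearMap.id ℂ L := by
    rw [adjoint_diamondL_comp, inner_self_eq_norm_sq_to_K, he]
    simp
  have hS1 : ‖S‖ ≤ 1 := (norm_diamondL_le ι e).trans_eq he
  -- With `S = (e ⋄ ·)` an isometry, `(e ∘ e) ⋄ k = S k S*`, and multiplying by `S*` and `S`
  -- recovers `k`. This is a representation with a single term, of cost at most `‖x‖ ‖w‖`.
  have hrep : (TensorProduct.mk ℂ E F x).lTensor (K L) w =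
      bimod _ S.adjoint S (diamondAmp ι E F (rk e e ⊗ₜ x) w) := by
    induction w with
    | zero => simp
    | add w w' h h' => simp [h, h']
    | tmul k y =>
      rw [diamondAmp_tmul, bimod, LinearMap.rTensor_tmul, diamondK_rk_left, sandwich_sandwich, hS]
      rfl
  refine (popNorm_le ⟨1, fun _ => S.adjoint, fun _ => S, fun _ => rk e e ⊗ₜ x, fun _ => w,
    by simpa using hrep, rfl⟩).trans ?_
  rw [Fin.sum_univ_one, A.nm_rk e e he he, LinearIsometryEquiv.norm_map]
  have h0 : 0 ≤ ‖x‖ * B.nm w := mul_nonneg (norm_nonneg _) (B.nm_nonneg w)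
  calc ‖S‖ * ‖x‖ * B.nm w * ‖S‖ = ‖S‖ * ‖S‖ * (‖x‖ * B.nm w) := by ring
    _ ≤ 1 * (‖x‖ * B.nm w) :=
      mul_le_mul_of_nonneg_right (mul_le_one₀ hS1 (norm_nonneg _) hS1) h0
    _ = _ := one_mul _

/-- The proto-operator-projective tensor product before completion. -/
abbrev popSpace : PQSpace L (PopTensor ι A B) := (popSeminorm ι A B).toSpace

/-- The identity map from `K ⊗ (E ⊗ F)` to the amplification of the proto-operator-projective
tensor product. -/
def toPopAmp : K L ⊗[ℂ] (E ⊗[ℂ] F) →ₗ[ℂ] Amp (popSpace ι A B) :=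
  (Amp.of (popSpace ι A B)).toLinearMap ∘ₗ
    (Underlying.of (popSeminorm ι A B)).toLinearMap.lTensor (K L)

/-- `Underlying.of` is the identity map into a type synonym, so its amplification is the identity as
well. -/
theorem nm_popSpace_lTensor_of (U : K L ⊗[ℂ] (E ⊗[ℂ] F)) :
    (popSpace ι A B).nm ((Underlying.of (popSeminorm ι A B)).toLinearMap.lTensor (K L) U) =
      popNorm ι A B U := by
  have h : (Underlying.of (popSeminorm ι A B)).toLinearMap.lTensor (K L) U = U :=
    LinearMap.congr_fun (LinearMap.lTensor_id (K L) (E ⊗[ℂ] F)) U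
  rw [h]
  rfl

theorem norm_toPopAmp (U : K L ⊗[ℂ] (E ⊗[ℂ] F)) : ‖toPopAmp ι A B U‖ = popNorm ι A B U :=
  nm_popSpace_lTensor_of ι A B U

/-- The bilinear operator which takes `x` and `a ⊗ y` to `a ⊗ (x ⊗ y)`. -/
def insertL : E →L[ℂ] Amp B →L[ℂ] Completion (Amp (popSpace ι A B)) :=
  LinearMap.mkContinuous₂
    (LinearMap.mk₂ ℂ
      (fun x w => ((toPopAmp ι A B ((TensorProduct.mk ℂ E F x).lTensor (K L) ((Amp.of B).symm w)) :
        Amp (popSpace ι A B)) : Completion (Amp (popSpace ι A B))))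
      (fun x x' w => by
        rw [map_add, LinearMap.lTensor_add, LinearMap.add_apply, map_add, Completion.coe_add])
      (fun c x w => by
        rw [map_smul, LinearMap.lTensor_smul, LinearMap.smul_apply, map_smul,
          Completion.coe_smul])
      (fun x w w' => by simp only [map_add, Completion.coe_add])
      (fun c x w => by simp only [map_smul, Completion.coe_smul]))
    1 fun x w => by
      rw [LinearMap.mk₂_apply, Completion.norm_coe, norm_toPopAmp, one_mul]
      exact popNorm_lTensor_mk_le ι A B x _

theorem insertL_of_tmul (x : E) (k : K L) (y : F) :
    insertL ι A B x (Amp.of B (k ⊗ₜ y)) = (toPopAmp ι A B (k ⊗ₜ (x ⊗ₜ y)) :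
      Amp (popSpace ι A B)) := rfl

theorem norm_insertL_le (x : E) : ‖insertL ι A B x‖ ≤ ‖x‖ := by
  refine ((insertL ι A B).le_opNorm x).trans ?_
  exact mul_le_of_le_one_left (norm_nonneg x) (LinearMap.mkContinuous₂_norm_le _ zero_le_one _)

end Insert

/-! ### Extension of a contraction from `L₁(X)` to vector-valued `L₁` -/

section IndicatorOperator

variable {X : Type*} [MeasurableSpace X] (μ : Measure X)

theorem toSpanSingleton_compLpL_indicatorConstLp {G : Type*} [NormedAddCommGroup G]
    [NormedSpace ℂ G] (w : G) {s : Set X} (hs : MeasurableSet s) (hμs : μ s ≠ ∞) (c : ℂ) :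
    (ContinuousLinearMap.toSpanSingleton ℂ w).compLpL 1 μ (indicatorConstLp 1 hs hμs c) =
      indicatorConstLp 1 hs hμs (c • w) := by
  apply Lp.ext
  filter_upwards [(ContinuousLinearMap.toSpanSingleton ℂ w).coeFn_compLpL (p := 1) (μ := μ)
    (indicatorConstLp 1 hs hμs c), indicatorConstLp_coeFn (p := 1) (hs := hs) (hμs := hμs) (c := c),
    indicatorConstLp_coeFn (p := 1) (hs := hs) (hμs := hμs) (c := c • w)] with t h1 h2 h3
  rw [h1, h2, h3, ContinuousLinearMap.toSpanSingleton_apply]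
  by_cases ht : t ∈ s <;> simp [ht]

theorem smul_indicatorConstLp_one {s : Set X} (hs : MeasurableSet s) (hμs : μ s ≠ ∞) (c : ℂ) :
    c • indicatorConstLp 1 hs hμs (1 : ℂ) = indicatorConstLp 1 hs hμs c := by
  apply Lp.ext
  filter_upwards [Lp.coeFn_smul c (indicatorConstLp 1 hs hμs (1 : ℂ)),
    indicatorConstLp_coeFn (p := 1) (hs := hs) (hμs := hμs) (c := c),
    indicatorConstLp_coeFn (p := 1) (hs := hs) (hμs := hμs) (c := (1 : ℂ))] with t h1 h2 h3
  rw [h1, Pi.smul_apply, h2, h3]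
  by_cases ht : t ∈ s <;> simp [ht]

variable {μ} {V W : Type*} [NormedAddCommGroup V] [NormedSpace ℂ V] [NormedAddCommGroup W]
  [NormedSpace ℂ W] (M : Lp ℂ 1 μ →L[ℂ] W →L[ℂ] V)

open scoped Classical in
/-- The operator-valued measure `s ↦ M χ_s`. -/
def indicatorOperator (s : Set X) : W →L[ℝ] V :=
  if h : MeasurableSet s ∧ μ s ≠ ∞ then
    (M (indicatorConstLp 1 h.1 h.2 (1 : ℂ))).restrictScalars ℝ
  -- An irrelevant default: additivity and domination are only required on measurable sets of finite
  -- measure.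
  else 0

theorem indicatorOperator_of_measurable {s : Set X} (hs : MeasurableSet s) (hμs : μ s ≠ ∞) :
    indicatorOperator M s = (M (indicatorConstLp 1 hs hμs (1 : ℂ))).restrictScalars ℝ :=
  dif_pos ⟨hs, hμs⟩

variable {M}

/-- The constant is `1` because `‖χ_s‖₁ = μ(s)` and `M` does not increase norms. It makes the
extension to `L₁(X, W)` a contraction. -/
theorem dominatedFinMeasAdditive_indicatorOperator (hM : ∀ z, ‖M z‖ ≤ ‖z‖) :
    DominatedFinMeasAdditive μ (indicatorOperator M) 1 := by
  refine ⟨fun s t hs ht hμs hμt hst => ?_, fun s hs hμs => ?_⟩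
  · rw [indicatorOperator_of_measurable M hs hμs, indicatorOperator_of_measurable M ht hμt,
      indicatorOperator_of_measurable M (hs.union ht) (measure_union_ne_top hμs hμt),
      indicatorConstLp_disjoint_union hs ht hμs hμt hst, map_add]
    rfl
  · rw [indicatorOperator_of_measurable M hs hμs.ne, ContinuousLinearMap.norm_restrictScalars,
      one_mul]
    refine (hM _).trans ?_
    rw [norm_indicatorConstLp one_ne_zero ENNReal.one_ne_top]
    simp

/-- Integrating `z(·) w` against `s ↦ M χ_s` gives back `M z w`. For `z = c χ_s` this is complex
linearity of `M`, which moves `c` from `w` to `χ_s`; the rest is additivity and density of simple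
functions. -/
theorem setToL1_indicatorOperator [CompleteSpace V] (hM : ∀ z, ‖M z‖ ≤ ‖z‖) (w : W)
    (z : Lp ℂ 1 μ) :
    L1.setToL1 (dominatedFinMeasAdditive_indicatorOperator hM)
      ((ContinuousLinearMap.toSpanSingleton ℂ w).compLpL 1 μ z) = M z w := by
  induction z using Lp.induction (p := 1) ENNReal.one_ne_top with
  | indicatorConst c hs hμs =>
    rw [Lp.simpleFunc.coe_indicatorConst, toSpanSingleton_compLpL_indicatorConstLp,
      L1.setToL1_indicatorConstLp _ hs hμs.ne, indicatorOperator_of_measurable M hs hμs.ne,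
      ContinuousLinearMap.coe_restrictScalars', map_smul, ← smul_indicatorConstLp_one μ hs hμs.ne c,
      map_smul, smul_apply]
  | add hf hg _ h h' =>
    rw [map_add, map_add, h, h', map_add]
    rfl
  | isClosed => exact isClosed_eq (by fun_prop) (by fun_prop)

end IndicatorOperator

/-! ### Equality of `‖·‖_pop` and the norm of `L₁(X, F)` on amplifications -/

section L1

variable {L : Type*} [NormedAddCommGroup L] [InnerProductSpace ℂ L] [CompleteSpace L]
  [Nontrivial L]
variable (ι : HilbertSquare L ≃ₗᵢ[ℂ] L)
variable {X : Type*} [MeasurableSpace X] (μ : Measure X)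

variable {F : Type*} [NormedAddCommGroup F] [NormedSpace ℂ F] (A : PQSpace L (Lp ℂ 1 μ))
  (B : PQSpace L F)

/-- The extended contraction is a left inverse of the amplification of `scalarTensor`, up to the
inclusion into the completion. On `k ⊗ (z ⊗ y)` it integrates `z(·) w` with `w = k ⊗ y`, and the
outcome is `insertL` at `z` and `w`. -/
theorem setToL1_alpha_scalarTensor (U : K L ⊗[ℂ] (Lp ℂ 1 μ ⊗[ℂ] F)) :
    L1.setToL1 (dominatedFinMeasAdditive_indicatorOperator (norm_insertL_le ι A B))
      (alpha μ B ((scalarTensor μ F).lTensor (K L) U)) = (toPopAmp ι A B U :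
        Amp (popSpace ι A B)) := by
  induction U with
  | zero => simp only [map_zero, Completion.coe_zero]
  | add U V hU hV => simp only [map_add, Completion.coe_add, hU, hV]
  | tmul k w =>
    induction w with
    | zero => simp only [TensorProduct.tmul_zero, map_zero, Completion.coe_zero]
    | add w w' h h' => simp only [TensorProduct.tmul_add, map_add, Completion.coe_add, h, h']
    | tmul z y =>
      rw [LinearMap.lTensor_tmul, alpha_scalarTensor_tmul, ← insertL_of_tmul,
        setToL1_indicatorOperator (norm_insertL_le ι A B)]

/-- A left inverse of norm at most `1` bounds the original element by its image. Only the underlying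
norm of `A` matters, so every quantization of `L₁(X)` is allowed. -/
theorem popNorm_le_nm_scalarTensor (U : K L ⊗[ℂ] (Lp ℂ 1 μ ⊗[ℂ] F)) :
    popNorm ι A B U ≤ (B.L1 μ).nm ((scalarTensor μ F).lTensor (K L) U) := by
  rw [← norm_toPopAmp, ← Completion.norm_coe, ← setToL1_alpha_scalarTensor]
  refine (L1.norm_setToL1_le_mul_norm _ zero_le_one _).trans_eq ?_
  rw [one_mul]
  rfl

theorem PQSpace.IsConvex.popNorm_eq {B : PQSpace L F} {p : ℝ≥0∞} [Fact (1 ≤ p)]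
    (hB : B.IsConvex p) (U : K L ⊗[ℂ] (Lp ℂ 1 μ ⊗[ℂ] F)) :
    popNorm ι ((schattenSpace L p).L1 μ) B U =
      (B.L1 μ).nm ((scalarTensor μ F).lTensor (K L) U) :=
  le_antisymm (popNorm_le_nm_scalarTensor ι μ _ B U) (hB.nm_scalarTensor_le_popNorm μ ι U)

end L1

/-! ### Passing amplified norms to the completion -/

section Extension

variable {L : Type*} [NormedAddCommGroup L] [InnerProductSpace ℂ L] [CompleteSpace L]
variable {E G : Type*} [SeminormedAddCommGroup E] [NormedSpace ℂ E]
  [SeminormedAddCommGroup G] [NormedSpace ℂ G]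

theorem PQSpace.completion_nm_coe (A : PQSpace L E) (u : K L ⊗[ℂ] E) :
    A.completion.nm ((Completion.toComplₗᵢ : E →ₗᵢ[ℂ] Completion E).toLinearMap.lTensor (K L) u) =
      A.nm u := by
  have h : gamma A ((Completion.toComplₗᵢ : E →ₗᵢ[ℂ] Completion E).toLinearMap.lTensor (K L) u) =
      ((Amp.of A u : Amp A) : Completion (Amp A)) := by
    induction u with
    | zero => simp only [map_zero, Completion.coe_zero]
    | add u v hu hv => simp only [map_add, Completion.coe_add, hu, hv]
    | tmul a x =>
      rw [LinearMap.lTensor_tmul, gamma_tmul]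
      exact ContinuousLinearMap.completion_apply_coe _ _
  change ‖gamma A _‖ = _
  rw [h, Completion.norm_coe, Amp.norm_of]

/-- Elements of `K ⊗ Ē` are simultaneously approximated by elements of `K ⊗ E` in the norm of
`K ⊗ Ē` and, after the application of a bounded operator, in `K ⊗ G`. -/
theorem exists_approx (A : PQSpace L (Completion E)) (B : PQSpace L G) (f : Completion E →L[ℂ] G)
    (u : K L ⊗[ℂ] Completion E) {ε : ℝ} (hε : 0 < ε) : ∃ v : K L ⊗[ℂ] E,
      A.nm (u - (Completion.toComplₗᵢ : E →ₗᵢ[ℂ] Completion E).toLinearMap.lTensor (K L) v) < ε ∧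
      B.nm (f.toLinearMap.lTensor (K L)
        (u - (Completion.toComplₗᵢ : E →ₗᵢ[ℂ] Completion E).toLinearMap.lTensor (K L) v)) < ε := by
  induction u generalizing ε with
  | zero => exact ⟨0, by simpa [PQSpace.nm, PQSeminorm.nm_zero] using hε⟩
  | add u u' h h' =>
    obtain ⟨v, h1, h2⟩ := h (half_pos hε)
    obtain ⟨v', h1', h2'⟩ := h' (half_pos hε)
    refine ⟨v + v', ?_, ?_⟩
    · rw [map_add, add_sub_add_comm]
      exact (A.nm_add _ _).trans_lt ((add_lt_add h1 h1').trans_eq (add_halves ε))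
    · rw [map_add, add_sub_add_comm, map_add]
      exact (B.nm_add _ _).trans_lt ((add_lt_add h2 h2').trans_eq (add_halves ε))
  | tmul a x =>
    -- For fixed `a` both errors are continuous in `y` and vanish at `y = x`; taking their maximum
    -- yields one `y ∈ E` that makes both small.
    have hc : Continuous fun y : Completion E =>
        max ‖Amp.tmulL A a (x - y)‖ ‖Amp.tmulL B a (f (x - y))‖ := by fun_prop
    obtain ⟨y, hy⟩ := (Completion.denseRange_coe (α := E)).exists_mem_open
      (isOpen_lt hc continuous_const) ⟨x, by simpa using hε⟩
    refine ⟨a ⊗ₜ y, ?_⟩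
    rw [LinearMap.lTensor_tmul, ← TensorProduct.tmul_sub, LinearMap.lTensor_tmul]
    exact max_lt_iff.1 hy

/-- The two sides agree on the image of `K ⊗ E`. Each varies by less than `ε / 2` when `u` is
replaced by a common approximant `w` from this image, so they differ by less than `ε` at `u`. -/
theorem PQSpace.nm_lTensor_eq_of_completion (A : PQSpace L E) (B : PQSpace L G)
    (f : Completion E →L[ℂ] G)
    (hf : ∀ u : K L ⊗[ℂ] E, B.nm (f.toLinearMap.lTensor (K L)
      ((Completion.toComplₗᵢ : E →ₗᵢ[ℂ] Completion E).toLinearMap.lTensor (K L) u)) = A.nm u)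
    (u : K L ⊗[ℂ] Completion E) :
    B.nm (f.toLinearMap.lTensor (K L) u) = A.completion.nm u := by
  refine eq_of_forall_dist_le fun ε hε => ?_
  obtain ⟨v, h1, h2⟩ := exists_approx A.completion B f u (half_pos hε)
  have h3 := hf v
  rw [← A.completion_nm_coe] at h3
  set w := (Completion.toComplₗᵢ : E →ₗᵢ[ℂ] Completion E).toLinearMap.lTensor (K L) v
  have h4 : |A.completion.nm u - A.completion.nm w| ≤ A.completion.nm (u - w) :=
    abs_sub_map_le_sub A.completion.toSeminorm u w
  have h5 : |B.nm (f.toLinearMap.lTensor (K L) u) - B.nm (f.toLinearMap.lTensor (K L) w)| ≤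
      B.nm (f.toLinearMap.lTensor (K L) (u - w)) := by
    rw [map_sub]
    exact abs_sub_map_le_sub B.toSeminorm _ _
  rw [Real.dist_eq]
  rw [abs_le] at h4 h5 ⊢
  constructor <;> linarith [h4.1, h4.2, h5.1, h5.2]

end Extension

/-! ### The isometric isomorphism and its amplification -/

section Isomorphism

variable {L : Type*} [NormedAddCommGroup L] [InnerProductSpace ℂ L] [CompleteSpace L]
  [Nontrivial L]
variable (ι : HilbertSquare L ≃ₗᵢ[ℂ] L)
variable {X : Type*} [MeasurableSpace X] (μ : Measure X)
variable {F : Type*} [NormedAddCommGroup F] [NormedSpace ℂ F]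
variable {p : ℝ≥0∞} [Fact (1 ≤ p)] {B : PQSpace L F}

/-- The operator `z ⊗ y ↦ z(·) y` on the proto-operator-projective tensor product, which is
isometric if `F` is `p`-convex. -/
def PQSpace.IsConvex.scalarTensorₗᵢ (hB : B.IsConvex p) :
    PopTensor ι ((schattenSpace L p).L1 μ) B →ₗᵢ[ℂ] Lp F 1 μ where
  toLinearMap := scalarTensor μ F ∘ₗ
    (Underlying.of (popSeminorm ι ((schattenSpace L p).L1 μ) B)).symm.toLinearMap
  norm_map' x := by
    have he := Underlying.norm_unitVec (L := L)
    -- Both underlying norms are amplified norms of `Q ⊗ x` with `Q` of rank one and norm one, so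
    -- isometry is the case `U = Q ⊗ x` of `PQSpace.IsConvex.popNorm_eq`.
    rw [← (B.L1 μ).nm_rk _ _ he he]
    exact (hB.popNorm_eq ι μ (rk _ _ ⊗ₜ
      (Underlying.of (popSeminorm ι ((schattenSpace L p).L1 μ) B)).symm x)).symm

variable [CompleteSpace F]

/-- The extension of `z ⊗ y ↦ z(·) y` to the completed tensor product. -/
def PQSpace.IsConvex.completedScalarTensor (hB : B.IsConvex p) :
    CompletedPopTensor ι ((schattenSpace L p).L1 μ) B →L[ℂ] Lp F 1 μ :=
  (hB.scalarTensorₗᵢ ι μ).toContinuousLinearMap.extend Completion.toComplL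

theorem PQSpace.IsConvex.completedScalarTensor_coe (hB : B.IsConvex p)
    (x : PopTensor ι ((schattenSpace L p).L1 μ) B) :
    hB.completedScalarTensor ι μ (x : CompletedPopTensor ι ((schattenSpace L p).L1 μ) B) =
      hB.scalarTensorₗᵢ ι μ x :=
  ContinuousLinearMap.extend_eq _ Completion.denseRange_coe
    (Completion.isUniformInducing_coe _) x

theorem PQSpace.IsConvex.completedScalarTensor_popTmul (hB : B.IsConvex p) (z : Lp ℂ 1 μ) (y : F) :
    hB.completedScalarTensor ι μ (popTmul ι ((schattenSpace L p).L1 μ) B z y) =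
      scalarTensor μ F (z ⊗ₜ y) :=
  hB.completedScalarTensor_coe ι μ _

theorem PQSpace.IsConvex.isometry_completedScalarTensor (hB : B.IsConvex p) :
    Isometry (hB.completedScalarTensor ι μ) := by
  refine AddMonoidHomClass.isometry_of_norm _ fun x => ?_
  induction x using Completion.induction_on with
  | hp => exact isClosed_eq (by fun_prop) (by fun_prop)
  | ih x => rw [hB.completedScalarTensor_coe, LinearIsometry.norm_map, Completion.norm_coe]

/-- The range is a subspace which contains `χ_s c`, the image of `χ_s ⊗ c`. It is closed, being the
isometric image of a complete space, and so contains every limit of simple functions. -/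
theorem PQSpace.IsConvex.surjective_completedScalarTensor (hB : B.IsConvex p) :
    Function.Surjective (hB.completedScalarTensor ι μ) := by
  intro f
  change f ∈ Set.range (hB.completedScalarTensor ι μ)
  induction f using Lp.induction (p := 1) ENNReal.one_ne_top with
  | indicatorConst c hs hμs =>
    refine ⟨popTmul ι _ B (indicatorConstLp 1 hs hμs.ne (1 : ℂ)) c, ?_⟩
    rw [hB.completedScalarTensor_popTmul, scalarTensor_tmul,
      toSpanSingleton_compLpL_indicatorConstLp, one_smul]
    rfl
  | add hf hg _ h h' =>
    obtain ⟨x, hx⟩ := h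
    obtain ⟨y, hy⟩ := h'
    exact ⟨x + y, by rw [map_add, hx, hy]⟩
  | isClosed => exact (hB.isometry_completedScalarTensor ι μ).isClosedEmbedding.isClosed_range

/-- The isomorphism of `L₁(X, ⁽ᵖ⁾ℂ) ⊗_pop F`, completed, onto `L₁(X, F)`. -/
def PQSpace.IsConvex.scalarTensorEquiv (hB : B.IsConvex p) :
    CompletedPopTensor ι ((schattenSpace L p).L1 μ) B ≃ₗ[ℂ] Lp F 1 μ :=
  LinearEquiv.ofBijective (hB.completedScalarTensor ι μ).toLinearMap
    ⟨(hB.isometry_completedScalarTensor ι μ).injective,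
      hB.surjective_completedScalarTensor ι μ⟩

/-- Before completion the claim is exactly `PQSpace.IsConvex.popNorm_eq`, since on the dense
subspace the extended operator is `scalarTensor`; the approximation lemma carries it to the
completion. -/
theorem PQSpace.IsConvex.isCompletelyIsometric_scalarTensorEquiv (hB : B.IsConvex p) :
    IsCompletelyIsometric (completedPop ι ((schattenSpace L p).L1 μ) B) (B.L1 μ)
      (hB.scalarTensorEquiv ι μ) := by
  refine PQSpace.nm_lTensor_eq_of_completion _ (B.L1 μ) (hB.completedScalarTensor ι μ) fun u => ?_
  rw [← LinearMap.comp_apply, ← LinearMap.lTensor_comp]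
  have h : (hB.completedScalarTensor ι μ).toLinearMap ∘ₗ
      (Completion.toComplₗᵢ : PopTensor ι ((schattenSpace L p).L1 μ) B →ₗᵢ[ℂ]
        CompletedPopTensor ι ((schattenSpace L p).L1 μ) B).toLinearMap =
      (hB.scalarTensorₗᵢ ι μ).toLinearMap :=
    LinearMap.ext (hB.completedScalarTensor_coe ι μ)
  rw [h]
  exact (hB.popNorm_eq ι μ u).symm

end Isomorphism

end Proto

end

theorem corollary6p10
    {L : Type*} [NormedAddCommGroup L] [InnerProductSpace ℂ L] [CompleteSpace L]
    [TopologicalSpace.SeparableSpace L] [Nontrivial L] (hL : ¬ FiniteDimensional ℂ L)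
    (ι : Proto.HilbertSquare L ≃ₗᵢ[ℂ] L)
    (p : ℝ≥0∞) [Fact (1 ≤ p)]
    {X : Type*} [MeasurableSpace X] (μ : Measure X)
    {F : Type*} [NormedAddCommGroup F] [NormedSpace ℂ F] [CompleteSpace F]
    (B : Proto.PQSpace L F) (hB : B.IsConvex p) :
    ∃ I : Proto.CompletedPopTensor ι ((Proto.schattenSpace L p).L1 μ) B ≃ₗ[ℂ] Lp F 1 μ,
      Proto.IsCompletelyIsometric
        (Proto.completedPop ι ((Proto.schattenSpace L p).L1 μ) B) (B.L1 μ) I ∧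
      ∀ (z : Lp ℂ 1 μ) (y : F),
        I (Proto.popTmul ι ((Proto.schattenSpace L p).L1 μ) B z y) =ᵐ[μ] fun t => z t • y := by
  exact ⟨hB.scalarTensorEquiv ι μ, hB.isCompletelyIsometric_scalarTensorEquiv ι μ, fun z y => by
    have h : hB.scalarTensorEquiv ι μ (Proto.popTmul ι ((Proto.schattenSpace L p).L1 μ) B z y) =
        Proto.scalarTensor μ F (z ⊗ₜ y) := hB.completedScalarTensor_popTmul ι μ z y
    rw [h]
    exact Proto.coeFn_scalarTensor_tmul μ z y⟩
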